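/- Let $n\ge 0$ and let $\mathcal C$ be the class of convex, strictly increasing functions $\varphi:[0,\infty)\to[0,\infty)$ with $\varphi(0)=0$ and $\varphi(1)=1$. For $\varphi\in\mathcal C$ and a finite multiset $\Lambda$ of vectors of $\mathbb R^n$, let $Z^+_\varphi\Lambda$ be the unique nonempty compact convex set whose support function is $$h_{Z^+_\varphi\Lambda}(u)=\inf\Big\{\lambda>0:\ \sum_{w\in\Lambda}\varphi\Big(\frac{\max\{0,\langle w,u\rangle\}}{\lambda}\Big)\le 1\Big\},\qquad u\in\mathbb R^n,$$ where the sum is taken with multiplicities, and let $Z^+_1\Lambda$ be this set for $\varphi(t)=t$. Let $V$ denote $n$-dimensional volume and let $\Lambda_\bot=\{e_1,\dots,e_n\}$ be the canonical basis of $\mathbb R^n$. A set of vectors is called obtuse if $\max\{0,\langle u,v\rangle\}=0$ for any two distinct elements $u,v$ of it. **Theorem.** Let $\varphi\in\mathcal C$ and let $\Lambda$ be a finite multiset of vectors that spans $\mathbb R^n$. Then $$\frac{V(Z^+_\varphi\Lambda)}{V(Z^+_1\Lambda)}\le\frac{V(Z^+_\varphi\Lambda_\bot)}{V(Z^+_1\Lambda_\bot)}.$$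 If $\varphi$ is not the identity on $[0,1]$, then equality holds if and only if the multiset of nonzero elements of $\Lambda$ is the image of an obtuse set under an element of $GL(n)$ (in particular, every nonzero element of $\Lambda$ has multiplicity one). If $\varphi(t)=t$ for all $t\in[0,1]$, then equality always holds. -/

import Mathlib

open MeasureTheory

noncomputable section

/-- The class `𝒞` of convex, strictly increasing functions `φ : [0, ∞) → [0, ∞)` with `φ 0 = 0`
and `φ 1 = 1`. Such a function is represented by a function on `ℝ` of which only the values on
`[0, ∞)` are ever used; that these are nonnegative follows from `zero` and `strictMono`. -/
structure OrliczClass (φ : ℝ → ℝ) : Prop where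
  convex : ConvexOn ℝ (Set.Ici 0) φ
  strictMono : StrictMonoOn φ (Set.Ici 0)
  zero : φ 0 = 0
  one : φ 1 = 1

/-- A finite multiset of vectors is spanning if its elements span the whole space. -/
def IsSpanning {n : ℕ} (Λ : Multiset (EuclideanSpace ℝ (Fin n))) : Prop :=
  Submodule.span ℝ {v | v ∈ Λ} = ⊤

/-- The function `u ↦ inf {r > 0 : ∑_{w ∈ Λ} φ (⟨w, u⟩₊ / r) ≤ 1}`, the sum being taken with
multiplicities. It is `0` if `⟨w, u⟩₊ = 0` for all `w ∈ Λ`. -/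
def orliczSupport {n : ℕ} (φ : ℝ → ℝ) (Λ : Multiset (EuclideanSpace ℝ (Fin n)))
    (u : EuclideanSpace ℝ (Fin n)) : ℝ :=
  sInf {r : ℝ | 0 < r ∧ (Λ.map fun w => φ (max 0 (inner ℝ w u) / r)).sum ≤ 1}

/-- The asymmetric Orlicz zonotope `Z⁺_φ Λ`: the compact convex set with support function
`orliczSupport φ Λ` (see `orliczZonotope_unique` below). -/
def orliczZonotope {n : ℕ} (φ : ℝ → ℝ) (Λ : Multiset (EuclideanSpace ℝ (Fin n))) :
    Set (EuclideanSpace ℝ (Fin n)) :=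
  {x | ∀ u, inner ℝ x u ≤ orliczSupport φ Λ u}

/-- The volume ratio `V(Z⁺_φ Λ) / V(Z⁺_1 Λ)`, where `Z⁺_1` belongs to the identity function. -/
def volumeRatio {n : ℕ} (φ : ℝ → ℝ) (Λ : Multiset (EuclideanSpace ℝ (Fin n))) : ℝ :=
  volume.real (orliczZonotope φ Λ) / volume.real (orliczZonotope (fun t => t) Λ)

/-- The canonical basis `Λ_⊥ = {e₁, …, eₙ}` as a multiset. -/
def canonicalBasis (n : ℕ) : Multiset (EuclideanSpace ℝ (Fin n)) :=
  Finset.univ.val.map fun i : Fin n => EuclideanSpace.single i (1 : ℝ)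

/-- A set of vectors is obtuse if `⟨u, v⟩₊ = 0` for any two distinct elements `u`, `v`. -/
def IsObtuse {n : ℕ} (S : Set (EuclideanSpace ℝ (Fin n))) : Prop :=
  ∀ u ∈ S, ∀ v ∈ S, u ≠ v → max 0 (inner ℝ u v) = 0

/-- `Λ` is the image of an obtuse set under an element of `GL(n)`. Since the obtuse set is a set,
every element of such a multiset `Λ` has multiplicity one. -/
def IsGLImageOfObtuse {n : ℕ} (Λ : Multiset (EuclideanSpace ℝ (Fin n))) : Prop :=
  ∃ (S : Finset (EuclideanSpace ℝ (Fin n)))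
    (g : EuclideanSpace ℝ (Fin n) ≃ₗ[ℝ] EuclideanSpace ℝ (Fin n)),
    IsObtuse (S : Set (EuclideanSpace ℝ (Fin n))) ∧ Λ = S.val.map g

open Classical in
/-- The multiset obtained from `Λ` by deleting all copies of the zero vector. -/
def nonzeroPart {n : ℕ} (Λ : Multiset (EuclideanSpace ℝ (Fin n))) :
    Multiset (EuclideanSpace ℝ (Fin n)) :=
  Λ.filter fun v => v ≠ 0

/- The lemmas below check that `orliczZonotope φ Λ` is indeed the unique nonempty compact
convex set with support function `orliczSupport φ Λ`. -/

theorem orlicz_feasible_nonempty {n : ℕ} {φ : ℝ → ℝ} (hφ : OrliczClass φ)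
    (Λ : Multiset (EuclideanSpace ℝ (Fin n))) (u : EuclideanSpace ℝ (Fin n)) :
    {r : ℝ | 0 < r ∧ (Λ.map fun w => φ (max 0 (inner ℝ w u) / r)).sum ≤ 1}.Nonempty := by
  set s : ℝ := (Λ.map fun w => max 0 (inner ℝ w u)).sum with hs
  have hs0 : 0 ≤ s := Multiset.sum_nonneg (by simp +contextual)
  refine ⟨s + 1, by linarith, ?_⟩
  have hle : ∀ w ∈ Λ, φ (max 0 (inner ℝ w u) / (s + 1)) ≤ max 0 (inner ℝ w u) / (s + 1) := by
    intro w hw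
    have h1 : max 0 (inner ℝ w u) ≤ s :=
      Multiset.single_le_sum (s := Λ.map fun w => max 0 (inner ℝ w u)) (by simp +contextual) _
        (Multiset.mem_map_of_mem _ hw)
    set t := max 0 (inner ℝ w u) / (s + 1) with ht
    have ht0 : 0 ≤ t := by positivity
    have ht1 : t ≤ 1 := by
      rw [ht, div_le_one (by linarith)]; linarith
    have := hφ.convex.2 (Set.mem_Ici.2 (zero_le_one (α := ℝ)))
      (Set.mem_Ici.2 (le_refl (0 : ℝ))) ht0 (sub_nonneg.2 ht1) (by ring)
    simpa [hφ.zero, hφ.one] using this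
  refine (Multiset.sum_map_le_sum_map _ _ hle).trans ?_
  rw [Multiset.sum_map_div, ← hs, div_le_one (by linarith)]
  linarith

theorem orlicz_feasible_bddBelow {n : ℕ} (φ : ℝ → ℝ)
    (Λ : Multiset (EuclideanSpace ℝ (Fin n))) (u : EuclideanSpace ℝ (Fin n)) :
    BddBelow {r : ℝ | 0 < r ∧ (Λ.map fun w => φ (max 0 (inner ℝ w u) / r)).sum ≤ 1} :=
  ⟨0, fun _ h => h.1.le⟩

theorem orliczSupport_add_le {n : ℕ} {φ : ℝ → ℝ} (hφ : OrliczClass φ)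
    (Λ : Multiset (EuclideanSpace ℝ (Fin n))) (u v : EuclideanSpace ℝ (Fin n)) :
    orliczSupport φ Λ (u + v) ≤ orliczSupport φ Λ u + orliczSupport φ Λ v := by
  have key : ∀ r ∈ {r : ℝ | 0 < r ∧ (Λ.map fun w => φ (max 0 (inner ℝ w u) / r)).sum ≤ 1},
      ∀ s ∈ {r : ℝ | 0 < r ∧ (Λ.map fun w => φ (max 0 (inner ℝ w v) / r)).sum ≤ 1},
      orliczSupport φ Λ (u + v) ≤ r + s := by
    rintro r ⟨hr, hr1⟩ s ⟨hs, hs1⟩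
    refine csInf_le (orlicz_feasible_bddBelow φ Λ (u + v)) ⟨add_pos hr hs, ?_⟩
    have hle : ∀ w ∈ Λ, φ (max 0 (inner ℝ w (u + v)) / (r + s)) ≤
        r / (r + s) * φ (max 0 (inner ℝ w u) / r) + s / (r + s) * φ (max 0 (inner ℝ w v) / s) := by
      intro w _
      have hxu : max 0 (inner ℝ w u) / r ∈ Set.Ici (0 : ℝ) := Set.mem_Ici.2 (by positivity)
      have hxv : max 0 (inner ℝ w v) / s ∈ Set.Ici (0 : ℝ) := Set.mem_Ici.2 (by positivity)
      have ha : 0 ≤ r / (r + s) := by positivity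
      have hb : 0 ≤ s / (r + s) := by positivity
      have h1 := hφ.convex.2 hxu hxv ha hb (by field_simp)
      refine le_trans (hφ.strictMono.monotoneOn (Set.mem_Ici.2 (by positivity))
        (Set.mem_Ici.2 (by simp only [smul_eq_mul]; positivity)) ?_) h1
      have h2 : max 0 (inner ℝ w (u + v)) ≤ max 0 (inner ℝ w u) + max 0 (inner ℝ w v) := by
        rw [inner_add_right]
        exact max_le (by positivity) (add_le_add (le_max_right _ _) (le_max_right _ _))
      have h3 : (r / (r + s)) • (max 0 (inner ℝ w u) / r) + (s / (r + s)) • (max 0 (inner ℝ w v) / s)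
          = (max 0 (inner ℝ w u) + max 0 (inner ℝ w v)) / (r + s) := by
        simp only [smul_eq_mul]; field_simp
      rw [h3]
      gcongr
    refine (Multiset.sum_map_le_sum_map _ _ hle).trans ?_
    rw [Multiset.sum_map_add, Multiset.sum_map_mul_left, Multiset.sum_map_mul_left]
    calc _ ≤ r / (r + s) * 1 + s / (r + s) * 1 := by gcongr
      _ = 1 := by field_simp
  have h1 : ∀ s ∈ {r : ℝ | 0 < r ∧ (Λ.map fun w => φ (max 0 (inner ℝ w v) / r)).sum ≤ 1},
      orliczSupport φ Λ (u + v) - s ≤ orliczSupport φ Λ u := fun s hs =>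
    le_csInf (orlicz_feasible_nonempty hφ Λ u) fun r hr => by linarith [key r hr s hs]
  have h2 : orliczSupport φ Λ (u + v) - orliczSupport φ Λ u ≤ orliczSupport φ Λ v :=
    le_csInf (orlicz_feasible_nonempty hφ Λ v) fun s hs => by linarith [h1 s hs]
  linarith

theorem orliczSupport_smul_le {n : ℕ} {φ : ℝ → ℝ} (hφ : OrliczClass φ)
    (Λ : Multiset (EuclideanSpace ℝ (Fin n))) {c : ℝ} (hc : 0 < c)
    (u : EuclideanSpace ℝ (Fin n)) :
    orliczSupport φ Λ (c • u) ≤ c * orliczSupport φ Λ u := by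
  have h : c⁻¹ * orliczSupport φ Λ (c • u) ≤ orliczSupport φ Λ u := by
    refine le_csInf (orlicz_feasible_nonempty hφ Λ u) ?_
    rintro r ⟨hr, hr1⟩
    rw [inv_mul_le_iff₀ hc]
    refine csInf_le (orlicz_feasible_bddBelow φ Λ (c • u)) ⟨by positivity, ?_⟩
    have hw : ∀ w : EuclideanSpace ℝ (Fin n),
        max 0 (inner ℝ w (c • u)) / (c * r) = max 0 (inner ℝ w u) / r := fun w => by
      rw [inner_smul_right, ← mul_div_mul_left _ r hc.ne', mul_max_of_nonneg _ _ hc.le, mul_zero]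
    simpa only [hw] using hr1
  rwa [inv_mul_le_iff₀ hc] at h

theorem orliczSupport_smul {n : ℕ} {φ : ℝ → ℝ} (hφ : OrliczClass φ)
    (Λ : Multiset (EuclideanSpace ℝ (Fin n))) {c : ℝ} (hc : 0 < c)
    (u : EuclideanSpace ℝ (Fin n)) :
    orliczSupport φ Λ (c • u) = c * orliczSupport φ Λ u := by
  refine le_antisymm (orliczSupport_smul_le hφ Λ hc u) ?_
  have := orliczSupport_smul_le hφ Λ (inv_pos.2 hc) (c • u)
  rw [inv_smul_smul₀ hc.ne'] at this
  rwa [le_inv_mul_iff₀ hc] at this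

theorem orliczSupport_nonneg {n : ℕ} {φ : ℝ → ℝ} (Λ : Multiset (EuclideanSpace ℝ (Fin n)))
    (u : EuclideanSpace ℝ (Fin n)) : 0 ≤ orliczSupport φ Λ u :=
  Real.sInf_nonneg fun _ h => h.1.le

theorem convex_orliczZonotope {n : ℕ} (φ : ℝ → ℝ) (Λ : Multiset (EuclideanSpace ℝ (Fin n))) :
    Convex ℝ (orliczZonotope φ Λ) := by
  intro x hx y hy a b ha hb hab u
  rw [inner_add_left, real_inner_smul_left, real_inner_smul_left]
  calc _ ≤ a * orliczSupport φ Λ u + b * orliczSupport φ Λ u := by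
        gcongr
        · exact hx u
        · exact hy u
    _ = orliczSupport φ Λ u := by rw [← add_mul, hab, one_mul]

theorem isCompact_orliczZonotope {n : ℕ} (φ : ℝ → ℝ)
    (Λ : Multiset (EuclideanSpace ℝ (Fin n))) : IsCompact (orliczZonotope φ Λ) := by
  have hclosed : IsClosed (orliczZonotope φ Λ) := by
    simp only [orliczZonotope, Set.ofPred_forall]
    exact isClosed_iInter fun u => isClosed_le (by fun_prop) continuous_const
  refine Metric.isCompact_of_isClosed_isBounded hclosed ?_
  refine (Metric.isBounded_iff_subset_closedBall 0).2
    ⟨∑ i : Fin n, (orliczSupport φ Λ (EuclideanSpace.single i 1) +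
      orliczSupport φ Λ (-EuclideanSpace.single i 1)), fun x hx => ?_⟩
  rw [mem_closedBall_zero_iff]
  have hx' : x = ∑ i : Fin n, x i • EuclideanSpace.single i (1 : ℝ) := by
    ext j
    simp [Pi.single_apply]
  rw [hx']
  refine (norm_sum_le _ _).trans (Finset.sum_le_sum fun i _ => ?_)
  have h1 := hx (EuclideanSpace.single i 1)
  have h2 := hx (-EuclideanSpace.single i 1)
  have h3 := orliczSupport_nonneg (φ := φ) Λ (EuclideanSpace.single i 1)
  have h4 := orliczSupport_nonneg (φ := φ) Λ (-EuclideanSpace.single i 1)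
  simp only [inner_neg_right, EuclideanSpace.inner_single_right, one_mul,
    conj_trivial] at h1 h2
  rw [norm_smul, PiLp.norm_single, norm_one, mul_one, Real.norm_eq_abs, abs_le]
  constructor <;> linarith

theorem isGreatest_orliczSupport {n : ℕ} {φ : ℝ → ℝ} (hφ : OrliczClass φ)
    (Λ : Multiset (EuclideanSpace ℝ (Fin n))) (u : EuclideanSpace ℝ (Fin n)) :
    IsGreatest ((fun x => inner ℝ x u) '' orliczZonotope φ Λ) (orliczSupport φ Λ u) := by
  refine ⟨?_, by rintro _ ⟨x, hx, rfl⟩; exact hx u⟩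
  have h0 : orliczSupport φ Λ 0 = 0 := by
    have := orliczSupport_smul hφ Λ (c := 2) (by norm_num) 0
    rw [smul_zero] at this
    linarith
  have hker : ∀ c : ℝ, c • u = 0 → RingHom.id ℝ c • orliczSupport φ Λ u = 0 := by
    intro c hc
    rcases smul_eq_zero.1 hc with h | h
    · simp [h]
    · simp [h, h0]
  obtain ⟨g, hg1, hg2⟩ := exists_extension_of_le_sublinear
    (LinearPMap.mkSpanSingleton' (σ := RingHom.id ℝ) u (orliczSupport φ Λ u) hker)
    (orliczSupport φ Λ)
    (fun c hc x => orliczSupport_smul hφ Λ hc x) (orliczSupport_add_le hφ Λ) (by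
      rintro ⟨x, hx⟩
      obtain ⟨c, rfl⟩ := Submodule.mem_span_singleton.1 hx
      rw [LinearPMap.mkSpanSingleton'_apply]
      simp only [RingHom.id_apply, smul_eq_mul]
      rcases lt_trichotomy c 0 with hc | hc | hc
      · have h1 := orliczSupport_nonneg (φ := φ) Λ u
        have h2 := orliczSupport_nonneg (φ := φ) Λ (c • u)
        nlinarith
      · simp [hc, h0]
      · exact (orliczSupport_smul hφ Λ hc u).ge)
  have hgu : g u = orliczSupport φ Λ u := by
    have hu : u ∈ (LinearPMap.mkSpanSingleton' (σ := RingHom.id ℝ) u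
        (orliczSupport φ Λ u) hker).domain := Submodule.mem_span_singleton_self u
    rw [hg1 ⟨u, hu⟩]
    exact (LinearPMap.mkSpanSingleton'_apply_self u _ hker hu)
  let x := (InnerProductSpace.toDual ℝ (EuclideanSpace ℝ (Fin n))).symm
    (LinearMap.toContinuousLinearMap g)
  have hx : ∀ v, inner ℝ x v = g v := fun v => by simp [x]
  exact ⟨x, fun v => by rw [hx]; exact hg2 v, by simp only [hx, hgu]⟩

theorem orliczZonotope_unique {n : ℕ} {φ : ℝ → ℝ} (hφ : OrliczClass φ)
    (Λ : Multiset (EuclideanSpace ℝ (Fin n))) (K : Set (EuclideanSpace ℝ (Fin n))) :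
    (IsCompact K ∧ Convex ℝ K ∧
      ∀ u, IsGreatest ((fun x => inner ℝ x u) '' K) (orliczSupport φ Λ u)) ↔
    K = orliczZonotope φ Λ := by
  refine ⟨?_, ?_⟩
  · rintro ⟨hK, hKc, hKs⟩
    refine Set.Subset.antisymm (fun x hx u => (hKs u).2 ⟨x, hx, rfl⟩) fun x hx => ?_
    by_contra hxK
    obtain ⟨f, s, hf, hs⟩ := geometric_hahn_banach_closed_point hKc hK.isClosed hxK
    obtain ⟨y, hy, hys⟩ := (hKs ((InnerProductSpace.toDual ℝ _).symm f)).1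
    have h1 := hx ((InnerProductSpace.toDual ℝ _).symm f)
    have h2 := hf y hy
    simp only at hys
    rw [← hys, real_inner_comm, real_inner_comm _ y, InnerProductSpace.toDual_symm_apply,
      InnerProductSpace.toDual_symm_apply] at h1
    linarith
  · rintro rfl
    exact ⟨isCompact_orliczZonotope φ Λ, convex_orliczZonotope φ Λ, isGreatest_orliczSupport hφ Λ⟩

end

/-!
Let `c` be the volume ratio of the canonical basis and `D Λ = c V(Z⁺_1 Λ) - V(Z⁺_φ Λ)` the volume
deficit of `Λ`. Let `P` be the orthogonal projection along `w ≠ 0`. Cutting along the lines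
parallel to `w` gives the deletion–contraction formula
`V(Z⁺_1 (w, Λ)) = V(Z⁺_1 Λ) + V(Z⁺_1 (w, P Λ))`. For `φ` the left side is at most the right side,
with equality if `(w, Λ)` is obtuse. Hence `D (w, Λ) ≥ D Λ + D (w, P Λ)`, again with equality in
the obtuse case. Contracting repeatedly reduces every multiset to orthogonal ones, on which `D`
vanishes, so `D ≥ 0` everywhere and `D = 0` on obtuse multisets; moreover, deletion and contraction
do not increase `D`.

Conversely, let `D Λ = 0`. After a linear map, `Λ` contains every `e_i`. Suppose that two elements
of `Λ` lie strictly on the same side of `e_i^⊥`. Contracting the elements of `Λ` in that hyperplane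
turns these two into positive multiples `α e_i` and `β e_i`. Merging them into `(α + β) e_i` leaves
`Z⁺_1` unchanged but strictly enlarges `Z⁺_φ` when `φ` is not the identity on `[0, 1]`, so
`D Λ > 0`, a contradiction. Thus the `i`-th coordinates of any two elements have product `≤ 0` for
every `i`, and summing over `i` shows that `Λ` is obtuse.
-/

section LineFibers

open scoped Pointwise

theorem exists_eq_Icc_of_isCompact_convex {A : Set ℝ} (hA : IsCompact A) (hA' : Convex ℝ A)
    (hne : A.Nonempty) : ∃ a b, a ≤ b ∧ A = Set.Icc a b :=
  ⟨sInf A, sSup A, csInf_le_csSup hne hA.bddBelow hA.bddAbove,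
    eq_Icc_of_connected_compact ⟨hne, hA'.isPreconnected⟩ hA⟩

theorem volume_add_of_isCompact_convex {A B : Set ℝ} (hA : IsCompact A) (hA' : Convex ℝ A)
    (hB : IsCompact B) (hB' : Convex ℝ B) (hAne : A.Nonempty) (hBne : B.Nonempty) :
    volume (A + B) = volume A + volume B := by
  obtain ⟨a, b, hab, rfl⟩ := exists_eq_Icc_of_isCompact_convex hA hA' hAne
  obtain ⟨c, d, hcd, rfl⟩ := exists_eq_Icc_of_isCompact_convex hB hB' hBne
  rw [Set.Icc_add_Icc hab hcd, Real.volume_Icc, Real.volume_Icc, Real.volume_Icc,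
    ← ENNReal.ofReal_add (by linarith) (by linarith)]
  congr 1
  ring

variable {E : Type*} [NormedAddCommGroup E] [InnerProductSpace ℝ E]

/-- The orthogonal projection onto the hyperplane `w^⊥`; it is the identity if `w = 0`. -/
noncomputable def hyperplaneProj (w : E) : E →ₗ[ℝ] E :=
  (ℝ ∙ w)ᗮ.starProjection

@[simp]
theorem inner_hyperplaneProj (w x : E) : inner ℝ w (hyperplaneProj w x) = 0 :=
  Submodule.mem_orthogonal_singleton_iff_inner_right.1 (Submodule.starProjection_apply_mem _ x)

theorem hyperplaneProj_eq_self {w x : E} (h : inner ℝ w x = 0) : hyperplaneProj w x = x :=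
  Submodule.starProjection_eq_self_iff.2 (Submodule.mem_orthogonal_singleton_iff_inner_right.2 h)

theorem hyperplaneProj_hyperplaneProj (w x : E) :
    hyperplaneProj w (hyperplaneProj w x) = hyperplaneProj w x :=
  hyperplaneProj_eq_self (inner_hyperplaneProj w x)

theorem eq_smul_add_hyperplaneProj (w x : E) :
    x = (inner ℝ w x / ‖w‖ ^ 2) • w + hyperplaneProj w x := by
  have h := Submodule.starProjection_add_starProjection_orthogonal (K := ℝ ∙ w) x
  rw [Submodule.starProjection_singleton] at h
  exact h.symm

@[simp]
theorem hyperplaneProj_self (w : E) : hyperplaneProj w w = 0 :=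
  Submodule.starProjection_orthogonal_apply_eq_zero (Submodule.mem_span_singleton_self w)

theorem inner_hyperplaneProj_hyperplaneProj (w x y : E) :
    inner ℝ (hyperplaneProj w x) (hyperplaneProj w y) =
      inner ℝ x y - inner ℝ w x * inner ℝ w y / ‖w‖ ^ 2 := by
  have h := congrArg (inner ℝ x) (eq_smul_add_hyperplaneProj w y)
  have h' := congrArg (inner ℝ · (hyperplaneProj w y)) (eq_smul_add_hyperplaneProj w x)
  simp only [inner_add_right, inner_add_left, real_inner_smul_left, real_inner_smul_right,
    inner_hyperplaneProj, real_inner_comm w x, mul_zero, zero_add] at h h'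
  rw [h, ← h']
  ring

theorem inner_hyperplaneProj_hyperplaneProj_nonpos {w x y : E} (hx : inner ℝ w x ≤ 0)
    (hy : inner ℝ w y ≤ 0) (hxy : inner ℝ x y ≤ 0) :
    inner ℝ (hyperplaneProj w x) (hyperplaneProj w y) ≤ 0 := by
  rw [inner_hyperplaneProj_hyperplaneProj]
  have := div_nonneg (mul_nonneg_of_nonpos_of_nonpos hx hy) (sq_nonneg ‖w‖)
  linarith

theorem hyperplaneProj_smul_add {w y : E} (hy : inner ℝ w y = 0) (r : ℝ) :
    hyperplaneProj w (r • w + y) = y := by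
  rw [map_add, map_smul, hyperplaneProj_self, smul_zero, zero_add, hyperplaneProj_eq_self hy]

theorem smul_add_eq_smul_add_iff {w y z : E} (hw : w ≠ 0) (hy : inner ℝ w y = 0)
    (hz : inner ℝ w z = 0) {r s : ℝ} : r • w + y = s • w + z ↔ r = s ∧ y = z := by
  refine ⟨fun h => ?_, by rintro ⟨rfl, rfl⟩; rfl⟩
  have hyz : y = z := by
    simpa only [hyperplaneProj_smul_add hy, hyperplaneProj_smul_add hz] using
      congrArg (hyperplaneProj w) h
  rw [hyz, add_left_inj] at h
  exact ⟨smul_left_injective ℝ hw h, hyz⟩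

/-- The parameters `r` for which the line `r ↦ r • w + y` meets `S`. -/
def lineFiber (w y : E) (S : Set E) : Set ℝ :=
  {r | r • w + y ∈ S}

theorem lineFiber_nonempty_iff {w y : E} (hy : inner ℝ w y = 0) {S : Set E} :
    (lineFiber w y S).Nonempty ↔ y ∈ hyperplaneProj w '' S := by
  refine ⟨fun ⟨r, hr⟩ => ⟨_, hr, hyperplaneProj_smul_add hy r⟩, ?_⟩
  rintro ⟨x, hx, rfl⟩
  refine ⟨inner ℝ w x / ‖w‖ ^ 2, ?_⟩
  rwa [lineFiber, Set.mem_ofPred_eq, ← eq_smul_add_hyperplaneProj]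

theorem isCompact_lineFiber {w : E} (hw : w ≠ 0) {S : Set E} (hS : IsCompact S) (y : E) :
    IsCompact (lineFiber w y S) :=
  ((Homeomorph.addRight y).isClosedEmbedding.comp
    (isClosedEmbedding_smul_left hw)).isCompact_preimage hS

theorem convex_lineFiber (w y : E) {S : Set E} (hS : Convex ℝ S) :
    Convex ℝ (lineFiber w y S) := by
  intro r hr s hs a b ha hb hab
  have : (a • r + b • s) • w + y = a • (r • w + y) + b • (s • w + y) := by
    linear_combination (norm := module) (-hab) • y
  rw [lineFiber, Set.mem_ofPred_eq, this]
  exact hS hr hs ha hb hab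

variable [FiniteDimensional ℝ E] [MeasurableSpace E] [BorelSpace E] (μ : Measure E)
  [μ.IsAddHaarMeasure]

/-- Coordinates adapted to the line spanned by `w`: the pair `(r, y)` stands for `r • w + y`. -/
noncomputable def lineProdEquiv {w : E} (hw : w ≠ 0) : (ℝ × (ℝ ∙ w)ᗮ) ≃L[ℝ] E :=
  (((LinearEquiv.toSpanNonzeroSingleton ℝ E w hw).prodCongr (LinearEquiv.refl ℝ (ℝ ∙ w)ᗮ)).trans
    (Submodule.prodEquivOfIsCompl _ _ (ℝ ∙ w).isCompl_orthogonal)).toContinuousLinearEquiv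

theorem exists_measure_eq_lintegral_lineFiber {w : E} (hw : w ≠ 0) :
    ∃ c : ENNReal, ∀ S : Set E, MeasurableSet S →
      μ S = c * ∫⁻ y : (ℝ ∙ w)ᗮ, volume (lineFiber w y S) := by
  let L := lineProdEquiv hw
  let ν : Measure E := (volume.prod volume).map L
  have : ν.IsAddHaarMeasure := L.isAddHaarMeasure_map _
  refine ⟨Measure.addHaarScalarFactor μ ν, fun S hS => ?_⟩
  conv_lhs => rw [Measure.isAddLeftInvariant_eq_smul μ ν]
  rw [Measure.smul_apply, Measure.map_apply L.continuous.measurable hS,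
    Measure.prod_apply_symm (L.continuous.measurable hS)]
  rfl

theorem measurable_volume_lineFiber {w : E} (hw : w ≠ 0) {S : Set E} (hS : MeasurableSet S) :
    Measurable fun y : (ℝ ∙ w)ᗮ => volume (lineFiber w y S) :=
  measurable_measure_prodMk_right ((lineProdEquiv hw).continuous.measurable hS)

variable {w : E} {X A B : Set E}

theorem measure_le_add_of_lineFiber_subset_add (hw : w ≠ 0) (hX : IsCompact X)
    (hA : IsCompact A) (hA' : Convex ℝ A) (hB : IsCompact B) (hB' : Convex ℝ B)
    (h : ∀ y, inner ℝ w y = 0 → lineFiber w y X ⊆ lineFiber w y A + lineFiber w y B) :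
    μ.real X ≤ μ.real A + μ.real B := by
  rw [Measure.real, Measure.real, Measure.real,
    ← ENNReal.toReal_add hA.measure_ne_top hB.measure_ne_top]
  refine ENNReal.toReal_mono (ENNReal.add_ne_top.2 ⟨hA.measure_ne_top, hB.measure_ne_top⟩) ?_
  obtain ⟨c, hc⟩ := exists_measure_eq_lintegral_lineFiber μ hw
  rw [hc X hX.measurableSet, hc A hA.measurableSet, hc B hB.measurableSet, ← mul_add,
    ← lintegral_add_left (measurable_volume_lineFiber hw hA.measurableSet)]
  gcongr with y
  have hy := h y (Submodule.mem_orthogonal_singleton_iff_inner_right.1 y.2)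
  rcases (lineFiber w y X).eq_empty_or_nonempty with h0 | ⟨r, hr⟩
  · simp [h0]
  · obtain ⟨s, hs, t, ht, -⟩ := hy hr
    exact (measure_mono hy).trans_eq (volume_add_of_isCompact_convex
      (isCompact_lineFiber hw hA _) (convex_lineFiber _ _ hA')
      (isCompact_lineFiber hw hB _) (convex_lineFiber _ _ hB') ⟨s, hs⟩ ⟨t, ht⟩)

theorem add_measure_le_of_lineFiber_add_subset (hw : w ≠ 0) (hX : IsCompact X)
    (hA : IsCompact A) (hA' : Convex ℝ A) (hB : IsCompact B) (hB' : Convex ℝ B)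
    (hAB : ∀ y, inner ℝ w y = 0 → ((lineFiber w y A).Nonempty ↔ (lineFiber w y B).Nonempty))
    (h : ∀ y, inner ℝ w y = 0 → lineFiber w y A + lineFiber w y B ⊆ lineFiber w y X) :
    μ.real A + μ.real B ≤ μ.real X := by
  rw [Measure.real, Measure.real, Measure.real,
    ← ENNReal.toReal_add hA.measure_ne_top hB.measure_ne_top]
  refine ENNReal.toReal_mono hX.measure_ne_top ?_
  obtain ⟨c, hc⟩ := exists_measure_eq_lintegral_lineFiber μ hw
  rw [hc X hX.measurableSet, hc A hA.measurableSet, hc B hB.measurableSet, ← mul_add,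
    ← lintegral_add_left (measurable_volume_lineFiber hw hA.measurableSet)]
  gcongr with y
  have hwy := Submodule.mem_orthogonal_singleton_iff_inner_right.1 y.2
  rcases (lineFiber w y A).eq_empty_or_nonempty with h0 | hne
  · have h0' : lineFiber w y B = ∅ := by
      rw [← Set.not_nonempty_iff_eq_empty, ← hAB y hwy, h0]
      exact Set.not_nonempty_empty
    simp [h0, h0']
  · rw [← volume_add_of_isCompact_convex (isCompact_lineFiber hw hA _) (convex_lineFiber _ _ hA')
      (isCompact_lineFiber hw hB _) (convex_lineFiber _ _ hB') hne ((hAB y hwy).1 hne)]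
    exact measure_mono (h y hwy)

end LineFibers

theorem measure_lt_of_convex_ssubset {E : Type*} [NormedAddCommGroup E] [NormedSpace ℝ E]
    [MeasurableSpace E] [OpensMeasurableSpace E] (μ : Measure E) [μ.IsOpenPosMeasure] {K G : Set E}
    (hK : IsClosed K) (hKμ : μ K ≠ ⊤) (hG : Convex ℝ G) (hG' : (interior G).Nonempty)
    (h : K ⊂ G) : μ K < μ G := by
  obtain ⟨hKG, x, hxG, hxK⟩ := Set.ssubset_iff_exists.1 h
  have hx : x ∈ closure (interior G) :=
    (hG.closure_interior_eq_closure_of_nonempty_interior hG').symm ▸ subset_closure hxG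
  have hpos : 0 < μ (G \ K) :=
    ((hK.isOpen_compl.inter isOpen_interior).measure_pos μ
      (mem_closure_iff.1 hx _ hK.isOpen_compl hxK)).trans_le
      (measure_mono fun y hy => ⟨interior_subset hy.2, hy.1⟩)
  calc μ K < μ K + μ (G \ K) := ENNReal.lt_add_right hKμ hpos.ne'
    _ = μ G := by
      rw [measure_add_sdiff hK.measurableSet.nullMeasurableSet,
        Set.union_eq_self_of_subset_left hKG]

theorem sum_min_smul_eq_of_obtuse {E ι : Type*} [NormedAddCommGroup E] [InnerProductSpace ℝ E]
    [Fintype ι] {p : ι → E} (hp : ∀ i j, i ≠ j → inner ℝ (p i) (p j) ≤ 0) {a b : ι → ℝ}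
    (h : ∑ i, a i • p i = ∑ i, b i • p i) :
    ∑ i, min (a i) (b i) • p i = ∑ i, a i • p i := by
  set c : ι → ℝ := fun i => min (a i) (b i) with hc
  have ha : ∑ i, a i • p i - ∑ i, c i • p i = ∑ i, (a i - c i) • p i := by
    simp only [sub_smul, Finset.sum_sub_distrib]
  have hb : ∑ i, a i • p i - ∑ i, c i • p i = ∑ i, (b i - c i) • p i := by
    simp only [h, sub_smul, Finset.sum_sub_distrib]
  -- The difference of the two sides has the coefficients `a - c` as well as `b - c`. These are
  -- nonnegative with disjoint supports, so obtuseness makes its inner product with itself `≤ 0`.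
  symm
  rw [← sub_eq_zero, ← real_inner_self_nonpos]
  nth_rw 1 [ha]
  rw [hb]
  simp only [sum_inner, inner_sum, real_inner_smul_left, real_inner_smul_right]
  refine Finset.sum_nonpos fun i _ => Finset.sum_nonpos fun j _ => ?_
  have haj : 0 ≤ a j - c j := sub_nonneg.2 (min_le_left _ _)
  have hbi : 0 ≤ b i - c i := sub_nonneg.2 (min_le_right _ _)
  rcases eq_or_ne i j with rfl | hij
  · have : (b i - c i) * (a i - c i) = 0 := by
      rcases le_total (a i) (b i) with hab | hab <;> simp [hc, hab]
    rw [← mul_assoc, this, zero_mul]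
  · exact mul_nonpos_of_nonneg_of_nonpos hbi
      (mul_nonpos_of_nonneg_of_nonpos haj (hp j i hij.symm))

theorem orliczClass_id : OrliczClass fun t => t where
  convex := convexOn_id (convex_Ici 0)
  strictMono := strictMono_id.strictMonoOn _
  zero := rfl
  one := rfl

namespace OrliczClass

variable {φ : ℝ → ℝ}

theorem nonneg (hφ : OrliczClass φ) {t : ℝ} (ht : 0 ≤ t) : 0 ≤ φ t :=
  hφ.zero.symm.trans_le (hφ.strictMono.monotoneOn Set.self_mem_Ici ht ht)

theorem map_mul_le (hφ : OrliczClass φ) {a t : ℝ} (ha : 0 ≤ a) (ha1 : a ≤ 1) (ht : 0 ≤ t) :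
    φ (a * t) ≤ a * φ t := by
  have := hφ.convex.2 (Set.mem_Ici.2 ht) Set.self_mem_Ici ha (sub_nonneg.2 ha1) (by ring)
  simpa [hφ.zero] using this

theorem le_self (hφ : OrliczClass φ) {t : ℝ} (ht : t ∈ Set.Icc (0 : ℝ) 1) : φ t ≤ t := by
  simpa [hφ.one] using hφ.map_mul_le ht.1 ht.2 zero_le_one

theorem superadditive (hφ : OrliczClass φ) {a b : ℝ} (ha : 0 ≤ a) (hb : 0 ≤ b) :
    φ a + φ b ≤ φ (a + b) := by
  rcases (add_nonneg ha hb).eq_or_lt with h | h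
  · obtain rfl : a = 0 := by linarith
    obtain rfl : b = 0 := by linarith
    simp [hφ.zero]
  · have h1 := hφ.map_mul_le (a := a / (a + b)) (t := a + b) (by positivity)
      (by rw [div_le_one h]; linarith) h.le
    have h2 := hφ.map_mul_le (a := b / (a + b)) (t := a + b) (by positivity)
      (by rw [div_le_one h]; linarith) h.le
    rw [div_mul_cancel₀ _ h.ne'] at h1 h2
    calc φ a + φ b ≤ a / (a + b) * φ (a + b) + b / (a + b) * φ (a + b) := add_le_add h1 h2
      _ = φ (a + b) := by field_simp

theorem lt_self (hφ : OrliczClass φ) (hne : ∃ t ∈ Set.Icc (0 : ℝ) 1, φ t ≠ t) {t : ℝ}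
    (ht : t ∈ Set.Ioo (0 : ℝ) 1) : φ t < t := by
  by_contra! hle
  have htt : φ t = t := le_antisymm (hφ.le_self ⟨ht.1.le, ht.2.le⟩) hle
  obtain ⟨s, hs, hsne⟩ := hne
  have hlt : φ s < s := (hφ.le_self hs).lt_of_ne hsne
  rcases lt_trichotomy s t with hst | rfl | hst
  · have h := hφ.convex.slope_mono_adjacent hs.1 (Set.mem_Ici.2 zero_le_one) hst ht.2
    rw [hφ.one, htt, div_self (sub_pos.2 ht.2).ne', div_le_one (sub_pos.2 hst)] at h
    linarith
  · exact hsne htt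
  · have h := hφ.convex.slope_mono_adjacent Set.self_mem_Ici hs.1 ht.1 hst
    rw [hφ.zero, htt, div_self (sub_pos.2 ht.1).ne', one_le_div (sub_pos.2 hst)] at h
    linarith

theorem exists_lt_one_sum_le (hφ : OrliczClass φ) (hne : ∃ t ∈ Set.Icc (0 : ℝ) 1, φ t ≠ t)
    {x y : ℝ} (hx : 0 < x) (hy : 0 < y) (hxy : x + y = 1) :
    ∃ r ∈ Set.Ioo (0 : ℝ) 1, φ (x / r) + φ (y / r) ≤ 1 := by
  have hcont (z : ℝ) (hz : 0 < z) : ContinuousAt (fun r => φ (z / r)) 1 := by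
    have hφz : ContinuousAt φ (z / 1) :=
      hφ.convex.continuousOn_interior.continuousAt (by
        rw [interior_Ici, div_one]
        exact Ioi_mem_nhds hz)
    exact hφz.comp (f := fun r : ℝ => z / r) (continuousAt_const.div continuousAt_id one_ne_zero)
  have hlt : φ (x / 1) + φ (y / 1) < 1 := by
    rw [div_one, div_one, ← hxy]
    exact add_lt_add (hφ.lt_self hne ⟨hx, by linarith⟩) (hφ.lt_self hne ⟨hy, by linarith⟩)
  have hnear := ((hcont x hx).add (hcont y hy)).eventually_lt_const hlt
  obtain ⟨r, hr, hr01⟩ :=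
    ((hnear.filter_mono nhdsWithin_le_nhds).and (Ioo_mem_nhdsLT zero_lt_one)).exists
  exact ⟨r, hr01, hr.le⟩

end OrliczClass

section PairwiseMultiset

variable {α β : Type*} {r : α → α → Prop}

theorem exists_eq_map_fin (Λ : Multiset α) :
    ∃ (k : ℕ) (v : Fin k → α), Λ = Finset.univ.val.map v := by
  induction Λ using Quotient.inductionOn with
  | h l => exact ⟨l.length, l.get, by simp [Fin.univ_val_map]⟩

theorem pairwise_map_of_forall_mem {s : β → β → Prop} {f : α → β} {Λ : Multiset α}
    (h : Λ.Pairwise r) (hf : ∀ a ∈ Λ, ∀ b ∈ Λ, r a b → s (f a) (f b)) :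
    (Λ.map f).Pairwise s := by
  obtain ⟨l, rfl, hl⟩ := h
  exact ⟨l.map f, rfl, List.pairwise_map.2 (hl.imp_of_mem fun ha hb => hf _ ha _ hb)⟩

variable [Std.Symm r]

theorem multiset_pairwise_cons {a : α} {Λ : Multiset α} :
    (a ::ₘ Λ).Pairwise r ↔ (∀ b ∈ Λ, r a b) ∧ Λ.Pairwise r := by
  induction Λ using Quotient.inductionOn with
  | h l =>
    simp only [Multiset.quot_mk_to_coe, Multiset.cons_coe, Multiset.pairwise_coe_iff_pairwise,
      List.pairwise_cons, Multiset.mem_coe]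

theorem multiset_pairwise_map_univ_iff {k : ℕ} {v : Fin k → α} :
    (Finset.univ.val.map v).Pairwise r ↔ ∀ i j, i ≠ j → r (v i) (v j) := by
  rw [Fin.univ_val_map, Multiset.pairwise_coe_iff_pairwise, List.pairwise_ofFn]
  refine ⟨fun h i j hij => ?_, fun h i j hij => h i j hij.ne⟩
  exact hij.lt_or_gt.elim (h (i := i) (j := j)) fun hji => symm (h hji)

theorem multiset_pairwise_iff_pair_le {Λ : Multiset α} :
    Λ.Pairwise r ↔ ∀ a b, a ::ₘ {b} ≤ Λ → r a b := by
  induction Λ using Quotient.inductionOn with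
  | h l =>
    rw [Multiset.quot_mk_to_coe, Multiset.pairwise_coe_iff_pairwise,
      List.pairwise_iff_forall_sublist]
    refine ⟨fun h a b hab => ?_, fun h a b hab => h a b hab.subperm⟩
    obtain ⟨l', hp, hs⟩ := Multiset.coe_le.1 hab
    rcases List.perm_pair.1 hp with rfl | rfl
    · exact h hs
    · exact symm (h hs)

theorem multiset_pairwise_of_le {Λ Γ : Multiset α} (hle : Λ ≤ Γ) (h : Γ.Pairwise r) :
    Λ.Pairwise r :=
  multiset_pairwise_iff_pair_le.2 fun a b hab =>
    multiset_pairwise_iff_pair_le.1 h a b (hab.trans hle)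

end PairwiseMultiset

instance symm_inner_nonpos {E : Type*} [NormedAddCommGroup E] [InnerProductSpace ℝ E] :
    Std.Symm fun u v : E => inner ℝ u v ≤ 0 :=
  ⟨fun u v h => by rwa [real_inner_comm]⟩

instance symm_inner_eq_zero {E : Type*} [NormedAddCommGroup E] [InnerProductSpace ℝ E] :
    Std.Symm fun u v : E => inner ℝ u v = 0 :=
  ⟨fun u v h => by rwa [real_inner_comm]⟩

section Support

variable {n : ℕ} {φ : ℝ → ℝ} {Λ : Multiset (EuclideanSpace ℝ (Fin n))}
  {u w : EuclideanSpace ℝ (Fin n)}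

theorem orliczZonotope_congr {ψ : ℝ → ℝ} {Γ : Multiset (EuclideanSpace ℝ (Fin n))}
    (h : ∀ u, orliczSupport φ Λ u = orliczSupport ψ Γ u) :
    orliczZonotope φ Λ = orliczZonotope ψ Γ := by
  simp only [orliczZonotope, h]

theorem orliczZonotope_mono {Γ : Multiset (EuclideanSpace ℝ (Fin n))}
    (h : ∀ u, orliczSupport φ Λ u ≤ orliczSupport φ Γ u) :
    orliczZonotope φ Λ ⊆ orliczZonotope φ Γ :=
  fun _ hx u => (hx u).trans (h u)

theorem orliczSupport_le {r : ℝ} (hr : 0 < r)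
    (h : (Λ.map fun w => φ (max 0 (inner ℝ w u) / r)).sum ≤ 1) : orliczSupport φ Λ u ≤ r :=
  csInf_le (orlicz_feasible_bddBelow φ Λ u) ⟨hr, h⟩

theorem div_le_one_of_feasible (hφ : OrliczClass φ) {r : ℝ} (hr : 0 < r)
    (h : (Λ.map fun w => φ (max 0 (inner ℝ w u) / r)).sum ≤ 1) (hw : w ∈ Λ) :
    max 0 (inner ℝ w u) / r ≤ 1 := by
  rw [← hφ.strictMono.le_iff_le (Set.mem_Ici.2 (by positivity)) (Set.mem_Ici.2 zero_le_one),
    hφ.one]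
  refine le_trans ?_ h
  refine Multiset.single_le_sum (s := Λ.map fun w => φ (max 0 (inner ℝ w u) / r)) ?_ _
    (Multiset.mem_map_of_mem _ hw)
  intro x hx
  obtain ⟨v, -, rfl⟩ := Multiset.mem_map.1 hx
  exact hφ.nonneg (by positivity)

theorem inner_le_orliczSupport (hφ : OrliczClass φ) (hw : w ∈ Λ) (u) :
    inner ℝ w u ≤ orliczSupport φ Λ u := by
  refine le_csInf (orlicz_feasible_nonempty hφ Λ u) ?_
  rintro r ⟨hr, h⟩
  exact (le_max_right _ _).trans ((div_le_one hr).1 (div_le_one_of_feasible hφ hr h hw))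

theorem mem_orliczZonotope_of_mem (hφ : OrliczClass φ) (hw : w ∈ Λ) : w ∈ orliczZonotope φ Λ :=
  inner_le_orliczSupport hφ hw

theorem zero_mem_orliczZonotope (φ : ℝ → ℝ) (Λ : Multiset (EuclideanSpace ℝ (Fin n))) :
    0 ∈ orliczZonotope φ Λ := fun u => by
  simpa using orliczSupport_nonneg Λ u

theorem orliczSupport_eq_zero (hφ : OrliczClass φ) (h : ∀ w ∈ Λ, inner ℝ w u ≤ 0) :
    orliczSupport φ Λ u = 0 := by
  refine le_antisymm (le_of_forall_pos_le_add fun ε hε => ?_) (orliczSupport_nonneg Λ u)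
  rw [zero_add]
  refine orliczSupport_le hε ?_
  rw [Multiset.map_congr rfl (g := fun _ => (0 : ℝ))
    fun w hw => by rw [max_eq_left (h w hw), zero_div, hφ.zero]]
  simp

theorem orliczSupport_id (Λ : Multiset (EuclideanSpace ℝ (Fin n)))
    (u : EuclideanSpace ℝ (Fin n)) :
    orliczSupport (fun t => t) Λ u = (Λ.map fun w => max 0 (inner ℝ w u)).sum := by
  set s := (Λ.map fun w => max 0 (inner ℝ w u)).sum with hs
  have hs0 : 0 ≤ s := Multiset.sum_nonneg (by simp +contextual)
  refine le_antisymm (le_of_forall_pos_le_add fun ε hε => ?_) ?_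
  · refine orliczSupport_le (by positivity) ?_
    rw [Multiset.sum_map_div, ← hs, div_le_one (by positivity)]
    linarith
  · refine le_csInf (orlicz_feasible_nonempty orliczClass_id Λ u) ?_
    rintro r ⟨hr, h⟩
    rwa [Multiset.sum_map_div, ← hs, div_le_one hr] at h

theorem orliczSupport_le_cons (hφ : OrliczClass φ) (w : EuclideanSpace ℝ (Fin n))
    (Λ : Multiset (EuclideanSpace ℝ (Fin n))) (u) :
    orliczSupport φ Λ u ≤ orliczSupport φ (w ::ₘ Λ) u := by
  refine csInf_le_csInf (orlicz_feasible_bddBelow φ Λ u) (orlicz_feasible_nonempty hφ _ u) ?_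
  rintro r ⟨hr, h⟩
  rw [Multiset.map_cons, Multiset.sum_cons] at h
  have h0 : 0 ≤ φ (max 0 (inner ℝ w u) / r) := hφ.nonneg (by positivity)
  exact ⟨hr, by linarith⟩

theorem orliczZonotope_subset_cons (hφ : OrliczClass φ) (w : EuclideanSpace ℝ (Fin n))
    (Λ : Multiset (EuclideanSpace ℝ (Fin n))) :
    orliczZonotope φ Λ ⊆ orliczZonotope φ (w ::ₘ Λ) :=
  orliczZonotope_mono (orliczSupport_le_cons hφ w Λ)

theorem orliczZonotope_zero_cons (hφ : OrliczClass φ)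
    (Λ : Multiset (EuclideanSpace ℝ (Fin n))) :
    orliczZonotope φ (0 ::ₘ Λ) = orliczZonotope φ Λ :=
  orliczZonotope_congr fun u => by simp [orliczSupport, hφ.zero]

theorem orliczZonotope_nonzeroPart (hφ : OrliczClass φ)
    (Λ : Multiset (EuclideanSpace ℝ (Fin n))) :
    orliczZonotope φ (nonzeroPart Λ) = orliczZonotope φ Λ := by
  have (u : EuclideanSpace ℝ (Fin n)) (r : ℝ) :
      ((nonzeroPart Λ).map fun w => φ (max 0 (inner ℝ w u) / r)).sum =
        (Λ.map fun w => φ (max 0 (inner ℝ w u) / r)).sum := by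
    unfold nonzeroPart
    induction Λ using Multiset.induction with
    | empty => simp
    | cons w Λ ih =>
      by_cases hw : w = 0
      · simp [hw, hφ.zero, ih]
      · simp [hw, ih]
  exact orliczZonotope_congr fun u => by simp only [orliczSupport, this]

theorem orliczZonotope_eq_of_eq_id (hφ : OrliczClass φ)
    (hid : ∀ t ∈ Set.Icc (0 : ℝ) 1, φ t = t) (Λ : Multiset (EuclideanSpace ℝ (Fin n))) :
    orliczZonotope φ Λ = orliczZonotope (fun t => t) Λ := by
  refine orliczZonotope_congr fun u => congrArg sInf (Set.ext fun r => and_congr_right fun hr => ?_)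
  have key (h1 : ∀ w ∈ Λ, max 0 (inner ℝ w u) / r ≤ 1) :
      (Λ.map fun w => φ (max 0 (inner ℝ w u) / r)).sum =
        (Λ.map fun w => max 0 (inner ℝ w u) / r).sum := by
    rw [Multiset.map_congr rfl fun w hw => hid _ ⟨by positivity, h1 w hw⟩]
  refine ⟨fun h => ?_, fun h => ?_⟩
  · rwa [← key fun w => div_le_one_of_feasible hφ hr h]
  · rwa [key fun w => div_le_one_of_feasible orliczClass_id hr h]

theorem orliczSupport_map {m : ℕ}
    (g : EuclideanSpace ℝ (Fin n) →ₗ[ℝ] EuclideanSpace ℝ (Fin m))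
    (Λ : Multiset (EuclideanSpace ℝ (Fin n))) (u : EuclideanSpace ℝ (Fin m)) :
    orliczSupport φ (Λ.map g) u = orliczSupport φ Λ (LinearMap.adjoint g u) := by
  simp [orliczSupport, LinearMap.adjoint_inner_right]

theorem orliczZonotope_map (hφ : OrliczClass φ) {m : ℕ}
    (g : EuclideanSpace ℝ (Fin n) →ₗ[ℝ] EuclideanSpace ℝ (Fin m))
    (Λ : Multiset (EuclideanSpace ℝ (Fin n))) :
    orliczZonotope φ (Λ.map g) = g '' orliczZonotope φ Λ := by
  symm
  rw [← orliczZonotope_unique hφ]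
  refine ⟨(isCompact_orliczZonotope φ Λ).image g.continuous_of_finiteDimensional,
    (convex_orliczZonotope φ Λ).linear_image g, fun u => ?_⟩
  rw [orliczSupport_map, Set.image_image]
  simpa only [LinearMap.adjoint_inner_right] using
    isGreatest_orliczSupport hφ Λ (LinearMap.adjoint g u)

theorem interior_orliczZonotope_nonempty (hφ : OrliczClass φ) (hΛ : IsSpanning Λ) :
    (interior (orliczZonotope φ Λ)).Nonempty := by
  rw [(convex_orliczZonotope φ Λ).interior_nonempty_iff_affineSpan_eq_top]
  have h0 : (0 : EuclideanSpace ℝ (Fin n)) ∈ affineSpan ℝ (orliczZonotope φ Λ) :=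
    subset_affineSpan ℝ _ (zero_mem_orliczZonotope φ Λ)
  rw [← AffineSubspace.direction_eq_top_iff_of_nonempty ⟨0, h0⟩, eq_top_iff, ← hΛ,
    Submodule.span_le]
  intro w hw
  simpa using AffineSubspace.vsub_mem_direction
    (subset_affineSpan ℝ _ (mem_orliczZonotope_of_mem hφ hw)) h0

theorem volume_real_orliczZonotope_pos (hφ : OrliczClass φ) (hΛ : IsSpanning Λ) :
    0 < volume.real (orliczZonotope φ Λ) :=
  ENNReal.toReal_pos (Measure.measure_pos_of_nonempty_interior _
    (interior_orliczZonotope_nonempty hφ hΛ)).ne' (isCompact_orliczZonotope φ Λ).measure_ne_top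

end Support

section Coefficients

variable {n k : ℕ} {φ : ℝ → ℝ}

theorem exists_map_canonicalBasis_eq (v : Fin k → EuclideanSpace ℝ (Fin n)) :
    ∃ g : EuclideanSpace ℝ (Fin k) →ₗ[ℝ] EuclideanSpace ℝ (Fin n),
      Finset.univ.val.map v = (canonicalBasis k).map g ∧ ∀ a, g a = ∑ i, a i • v i := by
  refine ⟨(EuclideanSpace.basisFun (Fin k) ℝ).toBasis.constr ℝ v, ?_, fun a => by
    simp [Module.Basis.constr_apply_fintype]⟩
  rw [canonicalBasis, Multiset.map_map]
  refine Multiset.map_congr rfl fun i _ => ?_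
  have := (EuclideanSpace.basisFun (Fin k) ℝ).toBasis.constr_basis ℝ v i
  rw [OrthonormalBasis.coe_toBasis, EuclideanSpace.basisFun_apply] at this
  exact this.symm

theorem mem_orliczZonotope_iff (hφ : OrliczClass φ) (v : Fin k → EuclideanSpace ℝ (Fin n))
    (x : EuclideanSpace ℝ (Fin n)) :
    x ∈ orliczZonotope φ (Finset.univ.val.map v) ↔
      ∃ a ∈ orliczZonotope φ (canonicalBasis k), x = ∑ i, a i • v i := by
  obtain ⟨g, h, hg⟩ := exists_map_canonicalBasis_eq v
  rw [h, orliczZonotope_map hφ]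
  simp only [Set.mem_image, hg, eq_comm]

theorem mem_orliczZonotope_cons_iff (hφ : OrliczClass φ) (w : EuclideanSpace ℝ (Fin n))
    (v : Fin k → EuclideanSpace ℝ (Fin n)) (x : EuclideanSpace ℝ (Fin n)) :
    x ∈ orliczZonotope φ (w ::ₘ Finset.univ.val.map v) ↔
      ∃ a ∈ orliczZonotope φ (canonicalBasis (k + 1)),
        x = a 0 • w + ∑ i : Fin k, a i.succ • v i := by
  have : w ::ₘ Finset.univ.val.map v =
      Finset.univ.val.map (Fin.cons w v : Fin (k + 1) → EuclideanSpace ℝ (Fin n)) := by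
    simp [Fin.univ_val_map, List.ofFn_succ]
  rw [this, mem_orliczZonotope_iff hφ]
  simp [Fin.sum_univ_succ]

theorem mem_orliczZonotope_tail_iff (hφ : OrliczClass φ)
    (v : Fin k → EuclideanSpace ℝ (Fin n)) (x : EuclideanSpace ℝ (Fin n)) :
    x ∈ orliczZonotope φ (Finset.univ.val.map v) ↔
      ∃ a ∈ orliczZonotope φ (canonicalBasis (k + 1)), x = ∑ i : Fin k, a i.succ • v i := by
  rw [← orliczZonotope_zero_cons hφ, mem_orliczZonotope_cons_iff hφ]
  simp

variable {a : EuclideanSpace ℝ (Fin k)}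

theorem orlicz_coeff_nonneg (hφ : OrliczClass φ) (ha : a ∈ orliczZonotope φ (canonicalBasis k))
    (i : Fin k) : 0 ≤ a i := by
  have h := ha (-EuclideanSpace.single i 1)
  rw [orliczSupport_eq_zero hφ] at h
  · simpa [EuclideanSpace.inner_single_right] using h
  · intro w hw
    obtain ⟨j, -, rfl⟩ := Multiset.mem_map.1 hw
    rw [inner_neg_right, EuclideanSpace.inner_single_left]
    simp only [map_one, one_mul, PiLp.single_apply]
    split_ifs <;> norm_num

theorem sum_map_canonicalBasis (f : ℝ → ℝ) (x : EuclideanSpace ℝ (Fin k)) :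
    ((canonicalBasis k).map fun w => f (inner ℝ w x)).sum = ∑ i, f (x i) := by
  simp only [canonicalBasis, Multiset.map_map, Function.comp_def,
    Finset.sum_map_val, EuclideanSpace.inner_single_left, map_one, one_mul]

theorem orlicz_coeff_le_one (hφ : OrliczClass φ) (ha : a ∈ orliczZonotope φ (canonicalBasis k))
    (i : Fin k) : a i ≤ 1 := by
  have h := ha (EuclideanSpace.single i 1)
  rw [EuclideanSpace.inner_single_right, conj_trivial, one_mul] at h
  refine h.trans (orliczSupport_le one_pos ?_)
  rw [sum_map_canonicalBasis fun t => φ (max 0 t / 1),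
    Finset.sum_eq_single i (fun j _ hj => by simp [hj, hφ.zero]) (by simp)]
  simp [hφ.one]

theorem orlicz_coeff_mono {b : EuclideanSpace ℝ (Fin k)}
    (ha : a ∈ orliczZonotope φ (canonicalBasis k)) (hb : ∀ i, 0 ≤ b i) (hab : ∀ i, b i ≤ a i) :
    b ∈ orliczZonotope φ (canonicalBasis k) := by
  intro x
  have hsum (r : ℝ) (x : EuclideanSpace ℝ (Fin k)) :
      ((canonicalBasis k).map fun w => φ (max 0 (inner ℝ w x) / r)).sum =
        ∑ i, φ (max 0 (x i) / r) :=
    sum_map_canonicalBasis (fun t => φ (max 0 t / r)) x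
  have hpos : orliczSupport φ (canonicalBasis k) (WithLp.toLp 2 fun i => max 0 (x i)) =
      orliczSupport φ (canonicalBasis k) x := by
    simp only [orliczSupport, hsum, le_max_left, max_eq_right]
  rw [← hpos]
  refine le_trans ?_ (ha _)
  simp only [PiLp.inner_apply, RCLike.inner_apply, conj_trivial]
  gcongr with i
  · exact hb i
  · exact le_max_right _ _
  · exact hab i

end Coefficients

section DeletionContraction

open scoped Pointwise

variable {n : ℕ} {φ : ℝ → ℝ} {w y : EuclideanSpace ℝ (Fin n)}
  {Λ : Multiset (EuclideanSpace ℝ (Fin n))}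

theorem exists_eq_smul_add_of_mem_cons (hφ : OrliczClass φ) {x : EuclideanSpace ℝ (Fin n)}
    (hx : x ∈ orliczZonotope φ (w ::ₘ Λ)) :
    ∃ r ∈ Set.Icc (0 : ℝ) 1, ∃ z ∈ orliczZonotope φ Λ, x = r • w + z ∧
      ∀ g : EuclideanSpace ℝ (Fin n) →ₗ[ℝ] EuclideanSpace ℝ (Fin n),
        r • w + g z ∈ orliczZonotope φ (w ::ₘ Λ.map g) := by
  obtain ⟨k, v, rfl⟩ := exists_eq_map_fin Λ
  obtain ⟨a, ha, rfl⟩ := (mem_orliczZonotope_cons_iff hφ w v x).1 hx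
  refine ⟨a 0, ⟨orlicz_coeff_nonneg hφ ha 0, orlicz_coeff_le_one hφ ha 0⟩, _,
    (mem_orliczZonotope_tail_iff hφ v _).2 ⟨a, ha, rfl⟩, rfl, fun g => ?_⟩
  rw [Multiset.map_map]
  exact (mem_orliczZonotope_cons_iff hφ w _ _).2 ⟨a, ha, by simp⟩

theorem lineFiber_orliczZonotope_cons_subset (hφ : OrliczClass φ) (hy : inner ℝ w y = 0) :
    lineFiber w y (orliczZonotope φ (w ::ₘ Λ)) ⊆ lineFiber w y (orliczZonotope φ Λ) +
      lineFiber w y (orliczZonotope φ (w ::ₘ Λ.map (hyperplaneProj w))) := by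
  intro r hr
  obtain ⟨t, -, z, hz, h, hg⟩ := exists_eq_smul_add_of_mem_cons hφ hr
  have hzy : hyperplaneProj w z = y := by
    simpa [hyperplaneProj_smul_add hy] using (congrArg (hyperplaneProj w) h).symm
  refine ⟨r - t, ?_, t, ?_, sub_add_cancel r t⟩
  · rwa [lineFiber, Set.mem_ofPred_eq, sub_smul, sub_add_eq_add_sub, h, add_sub_cancel_left]
  · have := hg (hyperplaneProj w)
    rwa [hzy] at this

theorem lineFiber_orliczZonotope_nonempty_iff (hφ : OrliczClass φ) (hy : inner ℝ w y = 0) :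
    (lineFiber w y (orliczZonotope φ Λ)).Nonempty ↔
      (lineFiber w y (orliczZonotope φ (w ::ₘ Λ.map (hyperplaneProj w)))).Nonempty := by
  rw [lineFiber_nonempty_iff hy, lineFiber_nonempty_iff hy, ← orliczZonotope_map hφ,
    ← orliczZonotope_map hφ, Multiset.map_cons, hyperplaneProj_self, orliczZonotope_zero_cons hφ,
    Multiset.map_map]
  simp only [Function.comp_def, hyperplaneProj_hyperplaneProj]

theorem volume_orliczZonotope_cons_le (hφ : OrliczClass φ) (hw : w ≠ 0)
    (Λ : Multiset (EuclideanSpace ℝ (Fin n))) :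
    volume.real (orliczZonotope φ (w ::ₘ Λ)) ≤ volume.real (orliczZonotope φ Λ) +
      volume.real (orliczZonotope φ (w ::ₘ Λ.map (hyperplaneProj w))) :=
  measure_le_add_of_lineFiber_subset_add volume hw (isCompact_orliczZonotope φ _)
    (isCompact_orliczZonotope φ _) (convex_orliczZonotope φ _)
    (isCompact_orliczZonotope φ _) (convex_orliczZonotope φ _)
    fun _ hy => lineFiber_orliczZonotope_cons_subset hφ hy

theorem volume_orliczZonotope_cons_eq (hφ : OrliczClass φ) (hw : w ≠ 0)
    (H : ∀ y, inner ℝ w y = 0 → ∀ s t : ℝ, s • w + y ∈ orliczZonotope φ Λ →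
      t • w + y ∈ orliczZonotope φ (w ::ₘ Λ.map (hyperplaneProj w)) →
      (s + t) • w + y ∈ orliczZonotope φ (w ::ₘ Λ)) :
    volume.real (orliczZonotope φ (w ::ₘ Λ)) = volume.real (orliczZonotope φ Λ) +
      volume.real (orliczZonotope φ (w ::ₘ Λ.map (hyperplaneProj w))) := by
  refine (volume_orliczZonotope_cons_le hφ hw Λ).antisymm ?_
  refine add_measure_le_of_lineFiber_add_subset volume hw (isCompact_orliczZonotope φ _)
    (isCompact_orliczZonotope φ _) (convex_orliczZonotope φ _)
    (isCompact_orliczZonotope φ _) (convex_orliczZonotope φ _)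
    (fun _ hy => lineFiber_orliczZonotope_nonempty_iff hφ hy) fun y hy => ?_
  rintro _ ⟨s, hs, t, ht, rfl⟩
  exact H y hy s t hs ht

theorem smul_add_mem_zonotope_cons {r : ℝ} (hr : r ∈ Set.Icc (0 : ℝ) 1)
    (hy : y ∈ orliczZonotope (fun t => t) Λ) :
    r • w + y ∈ orliczZonotope (fun t => t) (w ::ₘ Λ) := by
  intro u
  rw [orliczSupport_id, Multiset.map_cons, Multiset.sum_cons, ← orliczSupport_id, inner_add_left,
    real_inner_smul_left]
  refine add_le_add ?_ (hy u)
  calc r * inner ℝ w u ≤ r * max 0 (inner ℝ w u) :=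
        mul_le_mul_of_nonneg_left (le_max_right _ _) hr.1
    _ ≤ max 0 (inner ℝ w u) := mul_le_of_le_one_left (le_max_left _ _) hr.2

theorem volume_zonotope_cons (hw : w ≠ 0) (Λ : Multiset (EuclideanSpace ℝ (Fin n))) :
    volume.real (orliczZonotope (fun t => t) (w ::ₘ Λ)) =
      volume.real (orliczZonotope (fun t => t) Λ) +
        volume.real (orliczZonotope (fun t => t) (w ::ₘ Λ.map (hyperplaneProj w))) := by
  refine volume_orliczZonotope_cons_eq orliczClass_id hw fun y hy s t hs ht => ?_
  obtain ⟨r, hr, z, hz, h, -⟩ := exists_eq_smul_add_of_mem_cons orliczClass_id ht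
  rw [orliczZonotope_map orliczClass_id] at hz
  obtain ⟨x, -, rfl⟩ := hz
  obtain rfl : t = r := ((smul_add_eq_smul_add_iff hw hy (inner_hyperplaneProj w x)).1 h).1
  rw [add_comm s, add_smul, add_assoc]
  exact smul_add_mem_zonotope_cons hr hs

theorem smul_add_sum_min_smul_mem_orliczZonotope_cons (hφ : OrliczClass φ) {k : ℕ}
    (w : EuclideanSpace ℝ (Fin n)) (v : Fin k → EuclideanSpace ℝ (Fin n))
    {a b : EuclideanSpace ℝ (Fin (k + 1))} (ha : a ∈ orliczZonotope φ (canonicalBasis (k + 1)))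
    (hb : b ∈ orliczZonotope φ (canonicalBasis (k + 1))) :
    b 0 • w + ∑ i : Fin k, min (a i.succ) (b i.succ) • v i ∈
      orliczZonotope φ (w ::ₘ Finset.univ.val.map v) := by
  refine (mem_orliczZonotope_cons_iff hφ w v _).2
    ⟨WithLp.toLp 2 (Fin.cons (b 0) fun i => min (a i.succ) (b i.succ)),
      orlicz_coeff_mono hb ?_ ?_, by simp⟩
  · exact Fin.cases (by simpa using orlicz_coeff_nonneg hφ hb 0) fun i => by
      simpa using ⟨orlicz_coeff_nonneg hφ ha _, orlicz_coeff_nonneg hφ hb _⟩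
  · exact Fin.cases (by simp) fun i => by simp

theorem add_smul_add_mem_orliczZonotope_cons_of_obtuse (hφ : OrliczClass φ) (hw : w ≠ 0)
    (hwΛ : ∀ v ∈ Λ, inner ℝ w v ≤ 0) (hΛ : Λ.Pairwise fun u v => inner ℝ u v ≤ 0)
    (hy : inner ℝ w y = 0) {s t : ℝ} (hs : s • w + y ∈ orliczZonotope φ Λ)
    (ht : t • w + y ∈ orliczZonotope φ (w ::ₘ Λ.map (hyperplaneProj w))) :
    (s + t) • w + y ∈ orliczZonotope φ (w ::ₘ Λ) := by
  obtain ⟨k, v, rfl⟩ := exists_eq_map_fin Λ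
  have hv := multiset_pairwise_map_univ_iff.1 hΛ
  replace hwΛ (i : Fin k) : inner ℝ w (v i) ≤ 0 :=
    hwΛ _ (Multiset.mem_map_of_mem v (Finset.mem_univ_val i))
  have hsX := orliczZonotope_subset_cons hφ w _ hs
  rw [Multiset.map_map] at ht
  obtain ⟨a, ha, hsa⟩ := (mem_orliczZonotope_tail_iff hφ v _).1 hs
  obtain ⟨b, hb, htb⟩ := (mem_orliczZonotope_cons_iff hφ w _ _).1 ht
  have hP (c : Fin k → ℝ) : hyperplaneProj w (∑ i, c i • v i) =
      ∑ i, c i • (hyperplaneProj w ∘ v) i := by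
    simp
  have hsplit (c : Fin k → ℝ) := eq_smul_add_hyperplaneProj w (∑ i, c i • v i)
  have hperp (c : Fin k → ℝ) := inner_hyperplaneProj w (∑ i, c i • v i)
  rw [hsplit, smul_add_eq_smul_add_iff hw hy (hperp _)] at hsa
  rw [← hP, smul_add_eq_smul_add_iff hw hy (hperp _)] at htb
  -- The point with coefficients `b 0` and `c` lies on the line through `y`, beyond `(s + t) • w`.
  let c (i : Fin k) : ℝ := min (a i.succ) (b i.succ)
  have hyc : hyperplaneProj w (∑ i, c i • v i) = y := by
    rw [hP, sum_min_smul_eq_of_obtuse, ← hP, ← hsa.2]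
    · exact fun i j hij =>
        inner_hyperplaneProj_hyperplaneProj_nonpos (hwΛ i) (hwΛ j) (hv i j hij)
    · rw [← hP, ← hP, ← hsa.2, ← htb.2]
  have hcX := smul_add_sum_min_smul_mem_orliczZonotope_cons hφ w v ha hb
  change b 0 • w + ∑ i, c i • v i ∈ _ at hcX
  rw [hsplit c, hyc, ← add_assoc, ← add_smul, ← htb.1] at hcX
  have hca : inner ℝ w (∑ i, a i.succ • v i) ≤ inner ℝ w (∑ i, c i • v i) := by
    simp only [inner_sum, real_inner_smul_right]
    exact Finset.sum_le_sum fun i _ => mul_le_mul_of_nonpos_right (min_le_left _ _) (hwΛ i)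
  refine (convex_lineFiber w y (convex_orliczZonotope φ _)).ordConnected.out hsX hcX ⟨?_, ?_⟩
  · exact le_add_of_nonneg_right (htb.1 ▸ orlicz_coeff_nonneg hφ hb 0)
  · rw [hsa.1, add_comm]
    gcongr

end DeletionContraction

section Deficit

variable {n : ℕ} {φ : ℝ → ℝ}

theorem isSpanning_canonicalBasis (n : ℕ) : IsSpanning (canonicalBasis n) := by
  have h := (EuclideanSpace.basisFun (Fin n) ℝ).toBasis.span_eq
  rw [OrthonormalBasis.coe_toBasis] at h
  rw [IsSpanning, ← h]
  congr 1
  ext v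
  simp [canonicalBasis]

/-- The amount by which the volume of `Z⁺_φ Λ` falls short of the bound that the canonical basis
gives for it. -/
noncomputable def volumeDeficit (φ : ℝ → ℝ) (Λ : Multiset (EuclideanSpace ℝ (Fin n))) : ℝ :=
  volumeRatio φ (canonicalBasis n) * volume.real (orliczZonotope (fun t => t) Λ) -
    volume.real (orliczZonotope φ Λ)

theorem volumeDeficit_canonicalBasis (φ : ℝ → ℝ) (n : ℕ) :
    volumeDeficit φ (canonicalBasis n) = 0 := by
  rw [volumeDeficit, volumeRatio, div_mul_cancel₀, sub_self]
  exact (volume_real_orliczZonotope_pos orliczClass_id (isSpanning_canonicalBasis n)).ne'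

theorem volumeDeficit_map (hφ : OrliczClass φ)
    (g : EuclideanSpace ℝ (Fin n) →ₗ[ℝ] EuclideanSpace ℝ (Fin n))
    (Λ : Multiset (EuclideanSpace ℝ (Fin n))) :
    volumeDeficit φ (Λ.map g) = |LinearMap.det g| * volumeDeficit φ Λ := by
  have h {ψ : ℝ → ℝ} (hψ : OrliczClass ψ) : volume.real (orliczZonotope ψ (Λ.map g)) =
      |LinearMap.det g| * volume.real (orliczZonotope ψ Λ) := by
    rw [orliczZonotope_map hψ, Measure.real, Measure.addHaar_image_linearMap, ENNReal.toReal_mul,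
      ENNReal.toReal_ofReal (abs_nonneg _), Measure.real]
  rw [volumeDeficit, volumeDeficit, h hφ, h orliczClass_id]
  ring

theorem volumeDeficit_zero_cons (hφ : OrliczClass φ)
    (Λ : Multiset (EuclideanSpace ℝ (Fin n))) :
    volumeDeficit φ (0 ::ₘ Λ) = volumeDeficit φ Λ := by
  simp only [volumeDeficit, orliczZonotope_zero_cons hφ, orliczZonotope_zero_cons orliczClass_id]

theorem volumeDeficit_nonzeroPart (hφ : OrliczClass φ)
    (Λ : Multiset (EuclideanSpace ℝ (Fin n))) :
    volumeDeficit φ (nonzeroPart Λ) = volumeDeficit φ Λ := by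
  simp only [volumeDeficit, orliczZonotope_nonzeroPart hφ,
    orliczZonotope_nonzeroPart orliczClass_id]

theorem volumeDeficit_of_card_le (hφ : OrliczClass φ) {Λ : Multiset (EuclideanSpace ℝ (Fin n))}
    (h : Λ.card ≤ n) : volumeDeficit φ Λ = 0 := by
  have hpad : nonzeroPart (Λ + Multiset.replicate (n - Λ.card) 0) = nonzeroPart Λ := by
    rw [nonzeroPart, Multiset.filter_add, ← nonzeroPart, add_eq_left, Multiset.filter_eq_nil]
    exact fun v hv => not_not.2 (Multiset.eq_of_mem_replicate hv)
  rw [← volumeDeficit_nonzeroPart hφ, ← hpad, volumeDeficit_nonzeroPart hφ]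
  obtain ⟨k, v, hv⟩ := exists_eq_map_fin (Λ + Multiset.replicate (n - Λ.card) 0)
  obtain rfl : n = k := by simpa [h] using congrArg Multiset.card hv
  obtain ⟨g, hg, -⟩ := exists_map_canonicalBasis_eq v
  rw [hv, hg, volumeDeficit_map hφ, volumeDeficit_canonicalBasis, mul_zero]

theorem volumeDeficit_of_orthogonal (hφ : OrliczClass φ)
    {Λ : Multiset (EuclideanSpace ℝ (Fin n))} (h : Λ.Pairwise fun u v => inner ℝ u v = 0) :
    volumeDeficit φ Λ = 0 := by
  rw [← volumeDeficit_nonzeroPart hφ]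
  refine volumeDeficit_of_card_le hφ ?_
  have h0 (v) (hv : v ∈ nonzeroPart Λ) : v ≠ 0 := (Multiset.mem_filter.1 hv).2
  replace h : (nonzeroPart Λ).Pairwise fun u v => inner ℝ u v = 0 :=
    multiset_pairwise_of_le (Multiset.filter_le _ Λ) h
  obtain ⟨k, v, hv⟩ := exists_eq_map_fin (nonzeroPart Λ)
  rw [hv] at h h0 ⊢
  have hind : LinearIndependent ℝ v := linearIndependent_of_ne_zero_of_inner_eq_zero
    (fun i => h0 _ (Multiset.mem_map_of_mem v (Finset.mem_univ_val i)))
    (fun i j hij => multiset_pairwise_map_univ_iff.1 h i j hij)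
  simpa using hind.fintype_card_le_finrank

theorem volumeDeficit_add_le_cons (hφ : OrliczClass φ) {w : EuclideanSpace ℝ (Fin n)}
    (hw : w ≠ 0) (Λ : Multiset (EuclideanSpace ℝ (Fin n))) :
    volumeDeficit φ Λ + volumeDeficit φ (w ::ₘ Λ.map (hyperplaneProj w)) ≤
      volumeDeficit φ (w ::ₘ Λ) := by
  simp only [volumeDeficit, volume_zonotope_cons hw Λ]
  linarith [volume_orliczZonotope_cons_le hφ hw Λ]

theorem volumeDeficit_cons_of_obtuse (hφ : OrliczClass φ) {w : EuclideanSpace ℝ (Fin n)}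
    (hw : w ≠ 0) {Λ : Multiset (EuclideanSpace ℝ (Fin n))}
    (h : (w ::ₘ Λ).Pairwise fun u v => inner ℝ u v ≤ 0) :
    volumeDeficit φ (w ::ₘ Λ) =
      volumeDeficit φ Λ + volumeDeficit φ (w ::ₘ Λ.map (hyperplaneProj w)) := by
  obtain ⟨hwΛ, hΛ⟩ := multiset_pairwise_cons.1 h
  have hvol := volume_orliczZonotope_cons_eq hφ hw fun y hy s t hs ht =>
    add_smul_add_mem_orliczZonotope_cons_of_obtuse hφ hw hwΛ hΛ hy hs ht
  simp only [volumeDeficit, volume_zonotope_cons hw Λ, hvol]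
  ring

theorem map_hyperplaneProj_eq_self {E : Type*} [NormedAddCommGroup E] [InnerProductSpace ℝ E]
    {w : E} {Λ : Multiset E} (h : ∀ v ∈ Λ, inner ℝ w v = 0) : Λ.map (hyperplaneProj w) = Λ :=
  (Multiset.map_congr rfl fun v hv => hyperplaneProj_eq_self (h v hv)).trans Λ.map_id'

theorem deletionContraction_induction {E : Type*} [NormedAddCommGroup E] [InnerProductSpace ℝ E]
    {p : Multiset E → Prop} (orthogonal : ∀ Λ, Λ.Pairwise (fun u v => inner ℝ u v = 0) → p Λ)
    (step : ∀ w Λ, w ≠ 0 → p Λ → p (w ::ₘ Λ.map (hyperplaneProj w)) → p (w ::ₘ Λ)) (Λ) :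
    p Λ := by
  -- `I` collects the vectors along which the multiset has been contracted already.
  suffices ∀ (m : ℕ) (I J : Multiset E), J.card = m → I.Pairwise (fun u v => inner ℝ u v = 0) →
      (∀ u ∈ I, ∀ v ∈ J, inner ℝ u v = 0) → p (I + J) by
    simpa using this _ 0 Λ rfl ⟨[], by simp⟩ (by simp)
  intro m
  induction m with
  | zero =>
    intro I J hJ hI _
    rw [Multiset.card_eq_zero.1 hJ, add_zero]
    exact orthogonal I hI
  | succ m ih =>
    intro I K hK hI hIJ
    obtain ⟨w, J, rfl, hJ⟩ := Multiset.card_eq_succ_iff.1 hK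
    simp only [Multiset.mem_cons, forall_eq_or_imp] at hIJ
    have hwI (u) (hu : u ∈ I) : inner ℝ w u = 0 := by rw [real_inner_comm, (hIJ u hu).1]
    have hcontraction : p (w ::ₘ (I + J).map (hyperplaneProj w)) := by
      rw [Multiset.map_add, map_hyperplaneProj_eq_self hwI, ← Multiset.cons_add]
      refine ih _ _ (by rw [Multiset.card_map, hJ])
        (multiset_pairwise_cons.2 ⟨hwI, hI⟩) fun u hu _ hPv => ?_
      obtain ⟨v, hv, rfl⟩ := Multiset.mem_map.1 hPv
      rcases Multiset.mem_cons.1 hu with rfl | hu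
      · exact inner_hyperplaneProj u v
      · rw [← hyperplaneProj_eq_self (hwI u hu), inner_hyperplaneProj_hyperplaneProj,
          (hIJ u hu).2 v hv, hwI u hu]
        simp
    rw [Multiset.add_cons]
    rcases eq_or_ne w 0 with rfl | hw
    · rwa [map_hyperplaneProj_eq_self fun v _ => inner_zero_left v] at hcontraction
    · exact step w _ hw (ih I J hJ hI fun u hu => (hIJ u hu).2) hcontraction

theorem volumeDeficit_nonneg (hφ : OrliczClass φ) (Λ : Multiset (EuclideanSpace ℝ (Fin n))) :
    0 ≤ volumeDeficit φ Λ := by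
  induction Λ using deletionContraction_induction with
  | orthogonal Λ hΛ => exact (volumeDeficit_of_orthogonal hφ hΛ).ge
  | step w Λ hw h h' => exact (add_nonneg h h').trans (volumeDeficit_add_le_cons hφ hw Λ)

theorem volumeDeficit_of_obtuse (hφ : OrliczClass φ) {Λ : Multiset (EuclideanSpace ℝ (Fin n))}
    (h : Λ.Pairwise fun u v => inner ℝ u v ≤ 0) : volumeDeficit φ Λ = 0 := by
  induction Λ using deletionContraction_induction with
  | orthogonal Λ hΛ => exact volumeDeficit_of_orthogonal hφ hΛ
  | step w Λ hw ih ih' =>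
    obtain ⟨hwΛ, hΛ⟩ := multiset_pairwise_cons.1 h
    rw [volumeDeficit_cons_of_obtuse hφ hw h, ih hΛ, ih', add_zero]
    exact multiset_pairwise_cons.2 ⟨by simp, pairwise_map_of_forall_mem hΛ fun u hu v hv huv =>
      inner_hyperplaneProj_hyperplaneProj_nonpos (hwΛ u hu) (hwΛ v hv) huv⟩

theorem volumeDeficit_le_cons (hφ : OrliczClass φ) (w : EuclideanSpace ℝ (Fin n))
    (Λ : Multiset (EuclideanSpace ℝ (Fin n))) :
    volumeDeficit φ Λ ≤ volumeDeficit φ (w ::ₘ Λ) := by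
  rcases eq_or_ne w 0 with rfl | hw
  · rw [volumeDeficit_zero_cons hφ]
  · linarith [volumeDeficit_add_le_cons hφ hw Λ,
      volumeDeficit_nonneg hφ (w ::ₘ Λ.map (hyperplaneProj w))]

theorem volumeDeficit_mono (hφ : OrliczClass φ) : Monotone (volumeDeficit (n := n) φ) := by
  intro Λ Γ h
  obtain ⟨Γ, rfl⟩ := Multiset.le_iff_exists_add.1 h
  clear h
  induction Γ using Multiset.induction with
  | empty => rw [add_zero]
  | cons w Γ ih =>
    rw [Multiset.add_cons]
    exact ih.trans (volumeDeficit_le_cons hφ w _)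

theorem volumeDeficit_contraction_le (hφ : OrliczClass φ) (w : EuclideanSpace ℝ (Fin n))
    (Λ : Multiset (EuclideanSpace ℝ (Fin n))) :
    volumeDeficit φ (w ::ₘ Λ.map (hyperplaneProj w)) ≤ volumeDeficit φ (w ::ₘ Λ) := by
  rcases eq_or_ne w 0 with rfl | hw
  · rw [map_hyperplaneProj_eq_self fun v _ => inner_zero_left v]
  · linarith [volumeDeficit_add_le_cons hφ hw Λ, volumeDeficit_nonneg hφ Λ]

end Deficit

section Contraction

variable {E : Type*} [NormedAddCommGroup E] [InnerProductSpace ℝ E]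

theorem starProjection_orthogonal_sup [FiniteDimensional ℝ E] {U V : Submodule ℝ E} (h : U ⟂ V)
    (x : E) : (U ⊔ V)ᗮ.starProjection x = Vᗮ.starProjection (Uᗮ.starProjection x) := by
  refine Submodule.eq_starProjection_of_mem_orthogonal ?_ ?_
  · rw [← Submodule.inf_orthogonal]
    refine ⟨?_, Submodule.starProjection_apply_mem _ _⟩
    rw [Submodule.starProjection_orthogonal_val]
    exact sub_mem (Submodule.starProjection_apply_mem _ x)
      (h.symm.le (Submodule.starProjection_apply_mem _ _))
  · rw [Submodule.orthogonal_orthogonal, Submodule.starProjection_orthogonal_val,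
      Submodule.starProjection_orthogonal_val, sub_sub_eq_add_sub, add_sub_right_comm,
      sub_sub_cancel]
    exact Submodule.add_mem_sup (Submodule.starProjection_apply_mem _ _)
      (Submodule.starProjection_apply_mem _ _)

theorem span_setOf_mem_cons (w : E) (Γ : Multiset E) :
    Submodule.span ℝ {v | v ∈ w ::ₘ Γ} = (ℝ ∙ w) ⊔ Submodule.span ℝ {v | v ∈ Γ} := by
  rw [← Submodule.span_insert]
  congr 1
  ext v
  simp

theorem span_singleton_sup_span_map_hyperplaneProj (w : E) (Γ : Multiset E) :
    (ℝ ∙ w) ⊔ Submodule.span ℝ {v | v ∈ Γ.map (hyperplaneProj w)} =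
      (ℝ ∙ w) ⊔ Submodule.span ℝ {v | v ∈ Γ} := by
  have hsub (v : E) : v - hyperplaneProj w v ∈ ℝ ∙ w :=
    Submodule.mem_span_singleton.2 ⟨_, eq_sub_of_add_eq (eq_smul_add_hyperplaneProj w v).symm⟩
  refine le_antisymm (sup_le le_sup_left (Submodule.span_le.2 fun u hu => ?_))
    (sup_le le_sup_left (Submodule.span_le.2 fun v hv => ?_))
  · obtain ⟨v, hv, rfl⟩ := Multiset.mem_map.1 hu
    rw [← sub_sub_cancel v (hyperplaneProj w v)]
    exact sub_mem (Submodule.mem_sup_right (Submodule.subset_span hv))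
      (Submodule.mem_sup_left (hsub v))
  · rw [← sub_add_cancel v (hyperplaneProj w v)]
    exact Submodule.add_mem_sup (hsub v)
      (Submodule.subset_span (Multiset.mem_map_of_mem _ hv))

variable {n : ℕ} {φ : ℝ → ℝ}

theorem exists_contraction (hφ : OrliczClass φ) (Γ : Multiset (EuclideanSpace ℝ (Fin n))) :
    ∃ Γ' : Multiset (EuclideanSpace ℝ (Fin n)),
      Submodule.span ℝ {v | v ∈ Γ'} = Submodule.span ℝ {v | v ∈ Γ} ∧
        ∀ Λ : Multiset (EuclideanSpace ℝ (Fin n)),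
          volumeDeficit φ (Λ.map (Submodule.span ℝ {v | v ∈ Γ})ᗮ.starProjection + Γ') ≤
            volumeDeficit φ (Λ + Γ) := by
  induction hm : Γ.card generalizing Γ with
  | zero =>
    obtain rfl := Multiset.card_eq_zero.1 hm
    exact ⟨0, rfl, fun Λ => by simp [Submodule.starProjection_top]⟩
  | succ m ih =>
    obtain ⟨w, Γ, rfl, hΓ⟩ := Multiset.card_eq_succ_iff.1 hm
    obtain ⟨Γ', hspan, hle⟩ := ih (Γ.map (hyperplaneProj w)) (by rw [Multiset.card_map, hΓ])
    rw [span_setOf_mem_cons, ← span_singleton_sup_span_map_hyperplaneProj]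
    set S := Submodule.span ℝ {v | v ∈ Γ.map (hyperplaneProj w)}
    have hwS : (ℝ ∙ w) ⟂ S := by
      refine Submodule.isOrtho_span.2 fun u hu v hv => ?_
      obtain ⟨v, -, rfl⟩ := Multiset.mem_map.1 hv
      rw [Set.mem_singleton_iff.1 hu, inner_hyperplaneProj]
    have hw : Sᗮ.starProjection w = w := Submodule.starProjection_eq_self_iff.2
      (hwS.le (Submodule.mem_span_singleton_self w))
    refine ⟨w ::ₘ Γ', by rw [span_setOf_mem_cons, hspan], fun Λ => ?_⟩
    have hproj : Λ.map ((ℝ ∙ w) ⊔ S)ᗮ.starProjection =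
        (Λ.map (hyperplaneProj w)).map Sᗮ.starProjection := by
      rw [Multiset.map_map]
      exact Multiset.map_congr rfl fun x _ => starProjection_orthogonal_sup hwS x
    calc volumeDeficit φ (Λ.map ((ℝ ∙ w) ⊔ S)ᗮ.starProjection + w ::ₘ Γ')
        = volumeDeficit φ ((w ::ₘ Λ.map (hyperplaneProj w)).map Sᗮ.starProjection + Γ') := by
          rw [hproj, Multiset.map_cons, hw, Multiset.add_cons, Multiset.cons_add]
      _ ≤ volumeDeficit φ (w ::ₘ (Λ + Γ).map (hyperplaneProj w)) := by
          rw [Multiset.map_add, ← Multiset.cons_add]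
          exact hle _
      _ ≤ volumeDeficit φ (Λ + w ::ₘ Γ) := by
          rw [Multiset.add_cons]
          exact volumeDeficit_contraction_le hφ w _

end Contraction

section Strictness

variable {n : ℕ} {φ : ℝ → ℝ} {z : EuclideanSpace ℝ (Fin n)}

theorem max_zero_inner_smul {c : ℝ} (hc : 0 ≤ c) (v u : EuclideanSpace ℝ (Fin n)) :
    max 0 (inner ℝ (c • v) u) = c * max 0 (inner ℝ v u) := by
  rw [real_inner_smul_left, mul_max_of_nonneg _ _ hc, mul_zero]

theorem zonotope_merge {α β : ℝ} (hα : 0 ≤ α) (hβ : 0 ≤ β) (v : EuclideanSpace ℝ (Fin n))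
    (Λ : Multiset (EuclideanSpace ℝ (Fin n))) :
    orliczZonotope (fun t => t) (α • v ::ₘ β • v ::ₘ Λ) =
      orliczZonotope (fun t => t) ((α + β) • v ::ₘ Λ) := by
  refine orliczZonotope_congr fun u => ?_
  simp only [orliczSupport_id, Multiset.map_cons, Multiset.sum_cons, max_zero_inner_smul hα,
    max_zero_inner_smul hβ, max_zero_inner_smul (add_nonneg hα hβ)]
  ring

theorem orliczSupport_merge_le (hφ : OrliczClass φ) {α β : ℝ} (hα : 0 ≤ α) (hβ : 0 ≤ β)
    (v : EuclideanSpace ℝ (Fin n)) (Λ : Multiset (EuclideanSpace ℝ (Fin n)))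
    (u : EuclideanSpace ℝ (Fin n)) :
    orliczSupport φ (α • v ::ₘ β • v ::ₘ Λ) u ≤ orliczSupport φ ((α + β) • v ::ₘ Λ) u := by
  refine csInf_le_csInf (orlicz_feasible_bddBelow φ _ u) (orlicz_feasible_nonempty hφ _ u) ?_
  rintro r ⟨hr, h⟩
  refine ⟨hr, le_trans ?_ h⟩
  simp only [Multiset.map_cons, Multiset.sum_cons, max_zero_inner_smul hα,
    max_zero_inner_smul hβ, max_zero_inner_smul (add_nonneg hα hβ), ← add_assoc]
  gcongr
  rw [add_mul, add_div]
  exact hφ.superadditive (by positivity) (by positivity)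

theorem orliczSupport_parallel_lt (hφ : OrliczClass φ) (hne : ∃ t ∈ Set.Icc (0 : ℝ) 1, φ t ≠ t)
    (hz : z ≠ 0) {α β : ℝ} (hα : 0 < α) (hβ : 0 < β)
    {Γ : Multiset (EuclideanSpace ℝ (Fin n))} (hΓ : ∀ w ∈ Γ, inner ℝ w z = 0) :
    orliczSupport φ (α • z ::ₘ β • z ::ₘ Γ) z < inner ℝ ((α + β) • z) z := by
  have hzz : 0 < inner ℝ z z := real_inner_self_pos.2 hz
  have hq : 0 < (α + β) * inner ℝ z z := mul_pos (add_pos hα hβ) hzz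
  obtain ⟨r, ⟨hr0, hr1⟩, hr⟩ := hφ.exists_lt_one_sum_le hne (x := α / (α + β))
    (y := β / (α + β)) (by positivity) (by positivity) (by field_simp)
  rw [real_inner_smul_left]
  refine lt_of_le_of_lt (orliczSupport_le (r := r * ((α + β) * inner ℝ z z))
    (mul_pos hr0 hq) ?_) (mul_lt_of_lt_one_left hq hr1)
  have hΓ0 : (Γ.map fun w => φ (max 0 (inner ℝ w z) / (r * ((α + β) * inner ℝ z z)))).sum = 0 :=
    Multiset.sum_eq_zero <| Multiset.forall_mem_map_iff.2 fun w hw => by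
      rw [hΓ w hw, max_self, zero_div, hφ.zero]
  rw [Multiset.map_cons, Multiset.sum_cons, Multiset.map_cons, Multiset.sum_cons, hΓ0, add_zero,
    max_zero_inner_smul hα.le, max_zero_inner_smul hβ.le, max_eq_right hzz.le]
  convert hr using 3 <;> field_simp

theorem isSpanning_smul_cons {c : ℝ} (hc : c ≠ 0)
    {Γ : Multiset (EuclideanSpace ℝ (Fin n))}
    (hΓ : Submodule.span ℝ {v | v ∈ Γ} = (ℝ ∙ z)ᗮ) : IsSpanning (c • z ::ₘ Γ) := by
  rw [IsSpanning, span_setOf_mem_cons, hΓ, Submodule.span_singleton_smul_eq hc.isUnit,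
    Submodule.sup_orthogonal_of_hasOrthogonalProjection]

theorem volumeDeficit_pos_of_parallel (hφ : OrliczClass φ)
    (hne : ∃ t ∈ Set.Icc (0 : ℝ) 1, φ t ≠ t) (hz : z ≠ 0) {α β : ℝ} (hα : 0 < α) (hβ : 0 < β)
    {Γ : Multiset (EuclideanSpace ℝ (Fin n))}
    (hΓ : Submodule.span ℝ {v | v ∈ Γ} = (ℝ ∙ z)ᗮ) :
    0 < volumeDeficit φ (α • z ::ₘ β • z ::ₘ Γ) := by
  have hΓz (w) (hw : w ∈ Γ) : inner ℝ w z = 0 :=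
    Submodule.mem_orthogonal_singleton_iff_inner_left.1 (hΓ ▸ Submodule.subset_span hw)
  have hssubset : orliczZonotope φ (α • z ::ₘ β • z ::ₘ Γ) ⊂
      orliczZonotope φ ((α + β) • z ::ₘ Γ) :=
    (Set.ssubset_iff_of_subset
      (orliczZonotope_mono (orliczSupport_merge_le hφ hα.le hβ.le z Γ))).2
      ⟨_, mem_orliczZonotope_of_mem hφ (Multiset.mem_cons_self _ _), fun h =>
        (h z).not_gt (orliczSupport_parallel_lt hφ hne hz hα hβ hΓz)⟩
  have hlt : volume.real (orliczZonotope φ (α • z ::ₘ β • z ::ₘ Γ)) <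
      volume.real (orliczZonotope φ ((α + β) • z ::ₘ Γ)) :=
    ENNReal.toReal_strict_mono (isCompact_orliczZonotope φ _).measure_ne_top
      (measure_lt_of_convex_ssubset volume (isCompact_orliczZonotope φ _).isClosed
        (isCompact_orliczZonotope φ _).measure_ne_top (convex_orliczZonotope φ _)
        (interior_orliczZonotope_nonempty hφ
          (isSpanning_smul_cons (add_pos hα hβ).ne' hΓ)) hssubset)
  have hnonneg := volumeDeficit_nonneg hφ ((α + β) • z ::ₘ Γ)
  rw [volumeDeficit] at hnonneg ⊢
  rw [zonotope_merge hα.le hβ.le]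
  linarith

theorem volumeDeficit_pos_of_same_side (hφ : OrliczClass φ)
    (hne : ∃ t ∈ Set.Icc (0 : ℝ) 1, φ t ≠ t) {u v : EuclideanSpace ℝ (Fin n)}
    (huv : 0 < inner ℝ z u * inner ℝ z v) {Γ : Multiset (EuclideanSpace ℝ (Fin n))}
    (hΓ : Submodule.span ℝ {v | v ∈ Γ} = (ℝ ∙ z)ᗮ) :
    0 < volumeDeficit φ (u ::ₘ v ::ₘ Γ) := by
  wlog h : 0 < inner ℝ z u generalizing z with H
  · refine H (z := -z) (by simpa using huv) ?_ ?_
    · rw [hΓ, ← Set.neg_singleton, Submodule.span_neg]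
    · rw [inner_neg_left]
      exact neg_pos.2 (lt_of_le_of_ne (not_lt.1 h) (left_ne_zero_of_mul huv.ne'))
  have hz : z ≠ 0 := by
    rintro rfl
    simp at h
  obtain ⟨Γ', hspan, hle⟩ := exists_contraction hφ Γ
  specialize hle (u ::ₘ {v})
  simp only [hΓ, Submodule.orthogonal_orthogonal, Multiset.map_cons, Multiset.map_singleton,
    Submodule.starProjection_singleton, Multiset.cons_add, Multiset.singleton_add] at hle
  have hzz : 0 < ‖z‖ ^ 2 := by positivity
  exact (volumeDeficit_pos_of_parallel hφ hne hz (div_pos h hzz)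
    (div_pos (pos_of_mul_pos_right huv h.le) hzz) (hspan.trans hΓ)).trans_le hle

end Strictness

section Equality

variable {n : ℕ} {φ : ℝ → ℝ} {Λ : Multiset (EuclideanSpace ℝ (Fin n))}

theorem span_filter_eq_orthogonal_single (hΛ : ∀ i, EuclideanSpace.single i 1 ∈ Λ) (i : Fin n)
    [DecidablePred fun v : EuclideanSpace ℝ (Fin n) => v i = 0] :
    Submodule.span ℝ {v | v ∈ Λ.filter fun v => v i = 0} =
      (ℝ ∙ (EuclideanSpace.single i 1 : EuclideanSpace ℝ (Fin n)))ᗮ := by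
  refine le_antisymm (Submodule.span_le.2 fun v hv => ?_) fun x hx => ?_
  · rw [SetLike.mem_coe, Submodule.mem_orthogonal_singleton_iff_inner_right]
    rw [EuclideanSpace.inner_single_left, (Multiset.mem_filter.1 hv).2, mul_zero]
  · rw [Submodule.mem_orthogonal_singleton_iff_inner_right, EuclideanSpace.inner_single_left,
      map_one, one_mul] at hx
    rw [← (EuclideanSpace.basisFun (Fin n) ℝ).sum_repr x]
    refine Submodule.sum_mem _ fun j _ => ?_
    rcases eq_or_ne j i with rfl | hj
    · rw [EuclideanSpace.basisFun_repr, hx, zero_smul]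
      exact zero_mem _
    · refine Submodule.smul_mem _ _ (Submodule.subset_span (Multiset.mem_filter.2 ?_))
      rw [EuclideanSpace.basisFun_apply]
      exact ⟨hΛ j, by simp [hj.symm]⟩

open Classical in
theorem pairwise_obtuse_of_volumeDeficit_eq_zero (hφ : OrliczClass φ)
    (hne : ∃ t ∈ Set.Icc (0 : ℝ) 1, φ t ≠ t) (hΛ : ∀ i, EuclideanSpace.single i 1 ∈ Λ)
    (h : volumeDeficit φ Λ = 0) : Λ.Pairwise fun u v => inner ℝ u v ≤ 0 := by
  refine multiset_pairwise_iff_pair_le.2 fun u v huv => ?_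
  rw [PiLp.inner_apply]
  refine Finset.sum_nonpos fun i _ => ?_
  by_contra! hpos
  replace hpos : 0 < u i * v i := by simpa [mul_comm] using hpos
  have hle : u ::ₘ v ::ₘ Λ.filter (fun v => v i = 0) ≤ Λ := by
    have hfilter : (u ::ₘ {v}).filter (fun v => ¬v i = 0) = u ::ₘ {v} :=
      Multiset.filter_eq_self.2 <| by
        simp [left_ne_zero_of_mul hpos.ne', right_ne_zero_of_mul hpos.ne']
    calc u ::ₘ v ::ₘ Λ.filter (fun v => v i = 0)
        = (u ::ₘ {v}).filter (fun v => ¬v i = 0) + Λ.filter (fun v => v i = 0) := by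
          rw [hfilter, Multiset.cons_add, Multiset.singleton_add]
      _ ≤ Λ.filter (fun v => ¬v i = 0) + Λ.filter (fun v => v i = 0) := by gcongr
      _ = Λ := by rw [add_comm, Multiset.filter_add_not]
  have hlt := volumeDeficit_pos_of_same_side hφ hne (z := EuclideanSpace.single i 1) (u := u)
    (v := v) (by simpa only [EuclideanSpace.inner_single_left, map_one, one_mul])
    (span_filter_eq_orthogonal_single hΛ i)
  exact (hlt.trans_le (volumeDeficit_mono hφ hle)).ne' h

theorem exists_linearEquiv_single_mem_map (hΛ : IsSpanning Λ) :
    ∃ g : EuclideanSpace ℝ (Fin n) ≃ₗ[ℝ] EuclideanSpace ℝ (Fin n),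
      ∀ i, EuclideanSpace.single i 1 ∈ Λ.map g := by
  let b := Module.Basis.ofSpan (K := ℝ) hΛ.ge
  have hb (i) : b i ∈ Λ := Module.Basis.ofSpan_subset hΛ.ge (Set.mem_range_self i)
  let e := (EuclideanSpace.basisFun (Fin n) ℝ).toBasis
  refine ⟨b.equiv e (b.indexEquiv e), fun i => Multiset.mem_map.2
    ⟨b ((b.indexEquiv e).symm i), hb _, ?_⟩⟩
  rw [Module.Basis.equiv_apply, Equiv.apply_symm_apply,
    OrthonormalBasis.coe_toBasis, EuclideanSpace.basisFun_apply]

theorem isGLImageOfObtuse_nonzeroPart (g : EuclideanSpace ℝ (Fin n) ≃ₗ[ℝ] EuclideanSpace ℝ (Fin n))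
    (h : (Λ.map g).Pairwise fun u v => inner ℝ u v ≤ 0) :
    IsGLImageOfObtuse (nonzeroPart Λ) := by
  have hle : nonzeroPart Λ ≤ Λ := Multiset.filter_le _ Λ
  have hM := multiset_pairwise_of_le (Multiset.map_le_map hle) h
  have hnodup : ((nonzeroPart Λ).map g).Nodup := by
    refine Multiset.nodup_iff_le.2 fun x hx => ?_
    obtain ⟨v, hv, rfl⟩ := Multiset.mem_map.1 (Multiset.mem_of_le hx (Multiset.mem_cons_self _ _))
    have hv0 : g v = 0 := real_inner_self_nonpos.1 (multiset_pairwise_iff_pair_le.1 hM _ _ hx)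
    exact (Multiset.mem_filter.1 hv).2 (g.map_eq_zero_iff.1 hv0)
  refine ⟨⟨_, hnodup⟩, g.symm, fun u hu v hv huv => max_eq_left (hM.forall hu hv huv), ?_⟩
  simp only [Multiset.map_map, Function.comp_def, LinearEquiv.symm_apply_apply, Multiset.map_id']

theorem volumeDeficit_of_isGLImageOfObtuse (hφ : OrliczClass φ) (h : IsGLImageOfObtuse Λ) :
    volumeDeficit φ Λ = 0 := by
  obtain ⟨S, g, hS, rfl⟩ := h
  have hS' : S.val.Pairwise fun u v => inner ℝ u v ≤ 0 :=
    S.nodup.pairwise fun u hu v hv huv => max_eq_left_iff.1 (hS u hu v hv huv)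
  have := volumeDeficit_map hφ (g : EuclideanSpace ℝ (Fin n) →ₗ[ℝ] EuclideanSpace ℝ (Fin n)) S.val
  rw [volumeDeficit_of_obtuse hφ hS', mul_zero] at this
  exact this

theorem volumeDeficit_eq_zero_iff (hφ : OrliczClass φ)
    (hne : ∃ t ∈ Set.Icc (0 : ℝ) 1, φ t ≠ t) (hΛ : IsSpanning Λ) :
    volumeDeficit φ Λ = 0 ↔ IsGLImageOfObtuse (nonzeroPart Λ) := by
  refine ⟨fun h => ?_, fun h => ?_⟩
  · obtain ⟨g, hg⟩ := exists_linearEquiv_single_mem_map hΛ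
    refine isGLImageOfObtuse_nonzeroPart g (pairwise_obtuse_of_volumeDeficit_eq_zero hφ hne hg ?_)
    have := volumeDeficit_map hφ (g : EuclideanSpace ℝ (Fin n) →ₗ[ℝ] EuclideanSpace ℝ (Fin n)) Λ
    rwa [h, mul_zero] at this
  · rw [← volumeDeficit_nonzeroPart hφ, volumeDeficit_of_isGLImageOfObtuse hφ h]

theorem volumeRatio_of_eq_id (hφ : OrliczClass φ) (hid : ∀ t ∈ Set.Icc (0 : ℝ) 1, φ t = t)
    (hΛ : IsSpanning Λ) : volumeRatio φ Λ = 1 := by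
  rw [volumeRatio, orliczZonotope_eq_of_eq_id hφ hid]
  exact div_self (volume_real_orliczZonotope_pos orliczClass_id hΛ).ne'

end Equality

theorem theorem1p2 {n : ℕ} (φ : ℝ → ℝ) (hφ : OrliczClass φ)
    (Λ : Multiset (EuclideanSpace ℝ (Fin n))) (hΛ : IsSpanning Λ) :
    volumeRatio φ Λ ≤ volumeRatio φ (canonicalBasis n) ∧
    ((∃ t ∈ Set.Icc (0 : ℝ) 1, φ t ≠ t) →
      (volumeRatio φ Λ = volumeRatio φ (canonicalBasis n) ↔
        IsGLImageOfObtuse (nonzeroPart Λ))) ∧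
    ((∀ t ∈ Set.Icc (0 : ℝ) 1, φ t = t) →
      volumeRatio φ Λ = volumeRatio φ (canonicalBasis n)) := by
  have hpos := volume_real_orliczZonotope_pos orliczClass_id hΛ
  refine ⟨?_, fun hne => ?_, fun hid => ?_⟩
  · have := volumeDeficit_nonneg hφ Λ
    rw [volumeDeficit, sub_nonneg] at this
    rwa [volumeRatio, div_le_iff₀ hpos]
  · rw [← volumeDeficit_eq_zero_iff hφ hne hΛ, volumeDeficit, sub_eq_zero, volumeRatio,
      div_eq_iff hpos.ne', eq_comm]
  · rw [volumeRatio_of_eq_id hφ hid hΛ,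
      volumeRatio_of_eq_id hφ hid (isSpanning_canonicalBasis n)]
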